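/- **Setting.** A q.n.c. tomonoid is a commutative monoid $(\mathcal L;\odot,1)$ with a total order compatible with $\odot$ such that $a\le 1$ for all $a$, every non-empty subset has a supremum, and $a\odot\bigvee_\iota b_\iota=\bigvee_\iota(a\odot b_\iota)$ for every non-empty family whenever $a,b_\iota\in\mathcal L$. A filter $F$ of $\mathcal L$ is an upward closed submonoid. It induces the congruence $a\sim_F b$ iff $a\odot f\le b$ and $b\odot g\le a$ for some $f,g\in F$. Its classes ($F$-classes) are intervals, and the quotient $\mathcal P$ is again a commutative totally ordered monoid, where $[a]\le[b]$ iff $a'\le b'$ for some $a'\sim_F a$, $b'\sim_F b$; its identity is the class $F$. For an $F$-class $R$ and $f\in F$ let $\rho_R(f)\colon R\to R$, $x\mapsto f\odot x$, and $\Lambda^R=\{\rho_R(f):f\in F\}$. For $F$-classes $R$ and $T<F$, with $S=R\odot T$, let $\Lambda^{R,S}=\{R\to S,\ x\mapsto t\odot x \;:\; t\in T\}$. It is called trivial if $S$ has a least element $p$ and $\Lambda^{R,S}$ consists only of the constant map with value $p$. The pair $R,T$ is $\odot$-maximal if $R$ is the largest $X\in\mathcal P$ with $X\odot T=S$ and $T$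 is the largest $Y\in\mathcal P$ with $R\odot Y=S$. A set of self-maps of a chain $R$ is called Łukasiewicz, product, reversed product, or power if some order isomorphism from $R$ onto $[0,1]$, $(0,1]$, $[0,1)$, or $(0,1)$, respectively, conjugates it onto $\{x\mapsto (x+t-1)\vee 0: t\in[0,1]\}$, $\{x\mapsto tx: t\in(0,1]\}$, $\{x\mapsto \frac{(x+t-1)\vee0}{t}: t\in(0,1]\}$, or $\{x\mapsto x^{1/t}: t\in(0,1]\}$, respectively. Given an isomorphism of ordered monoids by which $F$ is identified with $((0,1];\le,\cdot,1)$, unit coordinates on $R$ consist of an order isomorphism identifying $R$ with one of the four intervals, together with a coefficient $\alpha_R>0$, such that for all $f\in F$ - $\rho_R(f)(r)=(r+\alpha_R\ln f)\vee0$ on $[0,1]$, if $\Lambda^R$ is Łukasiewicz; - $\rho_R(f)(r)=f^{\alpha_R}r$ on $(0,1]$, if $\Lambda^R$ is product; - $\rho_R(f)(r)=\bigl(1-\frac{1-r}{f^{\alpha_R}}\bigr)\vee0$ on $[0,1)$, if $\Lambda^R$ is reversed product; - $\rho_R(f)(r)=r^{1/f^{\alpha_R}}$ on $(0,1)$, if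 $\Lambda^R$ is power. **Theorem.** Let $\mathcal L$ be a q.n.c. tomonoid and $F$ a filter of $\mathcal L$ without a smallest element that is Archimedean (for $a<b<1$ in $F$ there is $n\ge1$ with $b^n\le a$). Assume that each $F$-class is order-isomorphic to a singleton or to a bounded real interval $(a,b)$, $(a,b]$, $[a,b)$, or $[a,b]$ with $a<b$. Let $R,T\in\mathcal P$ with $T<F$ be $\odot$-maximal and let $S=R\odot T$. Then $F$ is isomorphic to $((0,1];\le,\cdot,1)$. Moreover, for each identification of $F$ with $(0,1]$ and each of the following combinations of types of $\Lambda^R$ and $\Lambda^S$, unit coordinates on $R$ and on $S$ exist, and for any choice of them, with $\kappa=\alpha_S/\alpha_R$, the set $\Lambda^{R,S}$ is, in these coordinates, as follows. (i) $\Lambda^R$, $\Lambda^S$ Łukasiewicz: $\Lambda^{R,S}$ consists of the maps $\lambda_z\colon[0,1]\to[0,1]$, $r\mapsto(\kappa r+z)\vee0$, with $-\kappa\le z\le m$, for some $m\in[-\kappa,(1-\kappa)\wedge0]$. (ii) $\Lambda^R$ Łukasiewicz, $\Lambda^S$ reversed product: it consists of the maps $\lambda_z\colon[0,1]\to[0,1)$,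 $r\mapsto(1-e^{-\kappa(r+z)})\vee0$, with $-1\le z\le m$, for some $m\in[-1,0]$. (iii) $\Lambda^R$ product, $\Lambda^S$ Łukasiewicz: it consists of the maps $\lambda_z\colon(0,1]\to[0,1]$, $r\mapsto(\kappa\ln r+z)\vee0$, with $0\le z\le m$, for some $m\in[0,1]$. (iv) $\Lambda^R$, $\Lambda^S$ product: it consists of the maps $\lambda_z\colon(0,1]\to(0,1]$, $r\mapsto z\,r^{\kappa}$, with $0<z\le m$, for some $m\in(0,1]$. (v) $\Lambda^R$ product, $\Lambda^S$ reversed product: it consists of the maps $\lambda_z\colon(0,1]\to[0,1)$, $r\mapsto\bigl(1-\frac1{z\,r^{\kappa}}\bigr)\vee0$, either with all $z\ge1$, or with $1\le z\le m$ for some $m\ge1$. (vi) $\Lambda^R$ product, $\Lambda^S$ power: it consists of the maps $\lambda_z\colon(0,1]\to(0,1)$, $r\mapsto z^{r^{-\kappa}}$, either with all $0<z<1$, or with $0<z\le m$ for some $m\in(0,1)$. (vii) $\Lambda^R$, $\Lambda^S$ reversed product: $\Lambda^{R,S}$ is either trivial or contained in the set of maps $\lambda_z\colon[0,1)\to[0,1)$,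 $r\mapsto\bigl(1-\frac{(1-r)^{\kappa}}z\bigr)\vee0$, with $0<z\le m$, for some $m\in(0,1]$. (viii) $\Lambda^R$ power, $\Lambda^S$ reversed product: $\Lambda^{R,S}$ is either trivial or contained in the set of maps $\lambda_z\colon(0,1)\to[0,1)$, $r\mapsto\bigl(1-\frac{(-\ln r)^{\kappa}}z\bigr)\vee0$, either with all $z>0$, or with $0<z\le m$ for some $m>0$. (ix) $\Lambda^R$, $\Lambda^S$ power: it consists of the maps $\lambda_z\colon(0,1)\to(0,1)$, $r\mapsto z^{(-\ln r)^{\kappa}}$, either with all $0<z<1$, or with $0<z\le m$ for some $m\in(0,1)$. -/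

import Mathlib

/-- A quantic, negative, commutative totally ordered monoid ("q.n.c. tomonoid"). Compatibility of
the order with the product is `IsOrderedMonoid`; almost completeness and distributivity over
suprema refer to non-empty suprema. -/
class QNCTomonoid (L : Type*) [CommMonoid L] [LinearOrder L] : Prop extends IsOrderedMonoid L where
  negative : ∀ a : L, a ≤ 1
  almostComplete : ∀ s : Set L, s.Nonempty → ∃ b, IsLUB s b
  quantic : ∀ (a b : L) (s : Set L), s.Nonempty → IsLUB s b →
    IsLUB ((fun x => a * x) '' s) (a * b)

/-- A tomonoid is Archimedean if `a < b < 1` implies `b ^ n ≤ a` for some `n ≥ 1`. -/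
def IsArchimedeanTomonoid (M : Type*) [CommMonoid M] [LinearOrder M] : Prop :=
  ∀ a b : M, a < b → b < 1 → ∃ n : ℕ, 1 ≤ n ∧ b ^ n ≤ a

/-- The pair `r, t` is `⊙`-maximal: with `s = r ⊙ t`, `r` is the largest `x` with `x ⊙ t = s` and
`t` is the largest `y` with `r ⊙ y = s`. -/
def IsOdotMaximal {M : Type*} [Mul M] [LE M] (r t : M) : Prop :=
  IsGreatest {x | x * t = r * t} r ∧ IsGreatest {y | r * y = r * t} t

/-- Singletons and the bounded intervals `(a,b)`, `(a,b]`, `[a,b)`, `[a,b]` with `a < b`. -/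
def IsRealInterval (I : Set ℝ) : Prop :=
  (∃ a, I = {a}) ∨ ∃ a b, a < b ∧
    (I = Set.Ioo a b ∨ I = Set.Ioc a b ∨ I = Set.Ico a b ∨ I = Set.Icc a b)

/-- A filter: an upward closed submonoid. -/
structure TomonoidFilter (L : Type*) [CommMonoid L] [LinearOrder L] extends Submonoid L where
  upward : ∀ {f g : L}, f ∈ carrier → f ≤ g → g ∈ carrier

namespace TomonoidFilter

section Quot

variable {L : Type*} [CommMonoid L] [LinearOrder L]

/-- The relation `a ∼_F b`. -/
def Rel (F : TomonoidFilter L) (a b : L) : Prop :=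
  a = b ∨ (a < b ∧ ∃ f ∈ F.toSubmonoid, b * f ≤ a) ∨ (b < a ∧ ∃ f ∈ F.toSubmonoid, a * f ≤ b)

theorem rel_iff (F : TomonoidFilter L) (a b : L) :
    F.Rel a b ↔ (∃ f ∈ F.toSubmonoid, b * f ≤ a) ∧ ∃ f ∈ F.toSubmonoid, a * f ≤ b := by
  constructor
  · rintro (rfl | ⟨h, f, hf, hb⟩ | ⟨h, f, hf, hb⟩)
    · exact ⟨⟨1, F.one_mem, by simp⟩, ⟨1, F.one_mem, by simp⟩⟩
    · exact ⟨⟨f, hf, hb⟩, ⟨1, F.one_mem, by simpa using h.le⟩⟩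
    · exact ⟨⟨1, F.one_mem, by simpa using h.le⟩, ⟨f, hf, hb⟩⟩
  · rintro ⟨h1, h2⟩
    rcases lt_trichotomy a b with h | h | h
    · exact Or.inr (Or.inl ⟨h, h1⟩)
    · exact Or.inl h
    · exact Or.inr (Or.inr ⟨h, h2⟩)

variable [QNCTomonoid L] (F : TomonoidFilter L)

/-- The congruence induced by the filter `F`. -/
def con : Con L where
  r := F.Rel
  iseqv := by
    have key : ∀ a b c : L, (∃ f ∈ F.toSubmonoid, b * f ≤ a) → (∃ f ∈ F.toSubmonoid, c * f ≤ b) →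
        ∃ f ∈ F.toSubmonoid, c * f ≤ a := by
      rintro a b c ⟨f, hf, h1⟩ ⟨g, hg, h2⟩
      refine ⟨g * f, F.mul_mem hg hf, ?_⟩
      rw [← mul_assoc]
      exact (mul_le_mul_left h2 f).trans h1
    refine ⟨fun a => Or.inl rfl, fun {a b} h => ?_, fun {a b c} h1 h2 => ?_⟩
    · rw [rel_iff] at h ⊢
      exact ⟨h.2, h.1⟩
    · rw [rel_iff] at h1 h2 ⊢
      exact ⟨key a b c h1.1 h2.1, key c b a h2.2 h1.2⟩
  mul' := by
    have key : ∀ a b c d : L, (∃ f ∈ F.toSubmonoid, b * f ≤ a) →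
        (∃ f ∈ F.toSubmonoid, d * f ≤ c) → ∃ f ∈ F.toSubmonoid, b * d * f ≤ a * c := by
      rintro a b c d ⟨f, hf, h1⟩ ⟨g, hg, h2⟩
      refine ⟨f * g, F.mul_mem hf hg, ?_⟩
      rw [mul_mul_mul_comm]
      exact mul_le_mul' h1 h2
    intro a b c d h1 h2
    rw [rel_iff] at h1 h2 ⊢
    exact ⟨key a b c d h1.1 h2.1, key b a d c h1.2 h2.2⟩

/-- The quotient `𝒫` of `L` by `F`; its elements are the `F`-classes, and `1` is the class `F`. -/
def Quo : Type _ := F.con.Quotient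

instance : CommMonoid F.Quo := inferInstanceAs (CommMonoid F.con.Quotient)

/-- The `F`-class of an element. -/
def toQuo (a : L) : F.Quo := (a : F.con.Quotient)

theorem toQuo_surj (x : F.Quo) : ∃ a, F.toQuo a = x := Con.induction_on x fun a => ⟨a, rfl⟩

theorem toQuo_eq (a b : L) : F.toQuo a = F.toQuo b ↔ F.Rel a b := F.con.eq

theorem toQuo_mul (a b : L) : F.toQuo (a * b) = F.toQuo a * F.toQuo b := rfl

/-- `[a] ≤ [b]` if `a' ≤ b'` for some `a' ∼ a` and `b' ∼ b`. -/
instance : LE F.Quo := ⟨fun x y => ∃ a b, F.toQuo a = x ∧ F.toQuo b = y ∧ a ≤ b⟩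

noncomputable instance : LinearOrder F.Quo where
  le := (· ≤ ·)
  le_refl x := by
    obtain ⟨a, rfl⟩ := F.toQuo_surj x
    exact ⟨a, a, rfl, rfl, le_rfl⟩
  le_trans := by
    rintro x y z ⟨a, b, rfl, rfl, hab⟩ ⟨b', c, hb, rfl, hbc⟩
    rcases le_total a c with h | h
    · exact ⟨a, c, rfl, rfl, h⟩
    · obtain ⟨f, hf, hbf⟩ := ((F.rel_iff _ _).1 ((F.toQuo_eq b' b).1 hb)).1
      refine ⟨a, a, rfl, (F.toQuo_eq _ _).2 ((F.rel_iff _ _).2 ⟨?_, ?_⟩), le_rfl⟩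
      · exact ⟨1, F.one_mem, by simpa using h⟩
      · exact ⟨f, hf, (mul_le_mul_left hab f).trans (hbf.trans hbc)⟩
  le_antisymm := by
    rintro x y ⟨a, b, rfl, rfl, hab⟩ ⟨b', a', hb, ha, hba⟩
    obtain ⟨f, hf, h1⟩ := ((F.rel_iff _ _).1 ((F.toQuo_eq b' b).1 hb)).1
    obtain ⟨g, hg, h2⟩ := ((F.rel_iff _ _).1 ((F.toQuo_eq a' a).1 ha)).2
    refine (F.toQuo_eq _ _).2 ((F.rel_iff _ _).2 ⟨⟨f * g, F.mul_mem hf hg, ?_⟩,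
      ⟨1, F.one_mem, by simpa using hab⟩⟩)
    rw [← mul_assoc]
    exact (mul_le_mul_left (h1.trans hba) g).trans h2
  le_total x y := by
    obtain ⟨a, rfl⟩ := F.toQuo_surj x
    obtain ⟨b, rfl⟩ := F.toQuo_surj y
    rcases le_total a b with h | h
    · exact Or.inl ⟨a, b, rfl, rfl, h⟩
    · exact Or.inr ⟨b, a, rfl, rfl, h⟩
  toDecidableLE := Classical.decRel _

/-- An `F`-class as a subset of `L`. -/
def cls (R : F.Quo) : Set L := {a | F.toQuo a = R}

theorem toQuo_of_mem {f : L} (hf : f ∈ F.toSubmonoid) : F.toQuo f = 1 :=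
  (F.toQuo_eq f 1).2 ((F.rel_iff f 1).2
    ⟨⟨f, hf, by simp⟩, ⟨1, F.one_mem, by simpa using QNCTomonoid.negative f⟩⟩)

theorem cls_one : F.cls 1 = (F.toSubmonoid : Set L) := by
  ext a
  refine ⟨fun h => ?_, fun h => F.toQuo_of_mem h⟩
  obtain ⟨f, hf, hfa⟩ := ((F.rel_iff a 1).1 ((F.toQuo_eq a 1).1 h)).1
  exact F.upward hf (by simpa using hfa)

/-- `λ_f^R : R → R`, `x ↦ f ⊙ x`, for `f ∈ F`; as a function of `f` this is the homomorphism
`ρ_R`. -/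
def rho (R : F.Quo) (f : F.toSubmonoid) (x : F.cls R) : F.cls R :=
  ⟨f * x, by
    have hx : F.toQuo x = R := x.2
    change F.toQuo (f * x) = R
    rw [toQuo_mul, F.toQuo_of_mem f.2, hx, one_mul]⟩

/-- `Λ^R = {λ_f^R : f ∈ F}`. -/
def LambdaCls (R : F.Quo) : Set (F.cls R → F.cls R) := Set.range (F.rho R)

/-- `λ_t^{R,S} : R → S`, `x ↦ t ⊙ x`, for `t ∈ T`, where `S = R ⊙ T`. -/
def lambdaMap (R T : F.Quo) (t : F.cls T) (x : F.cls R) : F.cls (R * T) :=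
  ⟨t * x, by
    have hx : F.toQuo x = R := x.2
    have ht : F.toQuo t = T := t.2
    change F.toQuo (t * x) = R * T
    rw [toQuo_mul, hx, ht, mul_comm]⟩

/-- `Λ^{R,S} = {λ_t^{R,S} : t ∈ T}`, where `S = R ⊙ T`. -/
def LambdaPair (R T : F.Quo) : Set (F.cls R → F.cls (R * T)) := Set.range (F.lambdaMap R T)

/-- `Λ^{R,S}` is trivial: `S` has a bottom element `p`, and `Λ^{R,S}` consists only of the
constant map with value `p`. -/
def IsTrivialPair (R T : F.Quo) : Prop :=
  ∃ p : F.cls (R * T), (∀ s, p ≤ s) ∧ F.LambdaPair R T = {fun _ => p}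

end Quot

end TomonoidFilter

/-- Two sets of self-maps of chains are c-isomorphic: one arises from the other by conjugation
with an order isomorphism of the underlying chains. -/
def CIsomorphic {A B : Type*} [LE A] [LE B] (Φ : Set (A → A)) (Ψ : Set (B → B)) : Prop :=
  ∃ φ : A ≃o B, Ψ = (fun g => φ ∘ g ∘ φ.symm) '' Φ

/-- `Φ^Łu`. -/
def phiLuk : Set (Set.Icc (0 : ℝ) 1 → Set.Icc (0 : ℝ) 1) :=
  Set.range fun (t : Set.Icc (0 : ℝ) 1) x => ⟨max ((x : ℝ) + t - 1) 0, le_max_right _ _,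
    max_le (by linarith [x.2.2, t.2.2]) zero_le_one⟩

/-- `Φ^Pr`. -/
def phiProd : Set (Set.Ioc (0 : ℝ) 1 → Set.Ioc (0 : ℝ) 1) :=
  Set.range fun (t : Set.Ioc (0 : ℝ) 1) x => ⟨t * x, mul_pos t.2.1 x.2.1,
    mul_le_one₀ t.2.2 x.2.1.le x.2.2⟩

/-- `Φ^rP`. -/
def phiRevProd : Set (Set.Ico (0 : ℝ) 1 → Set.Ico (0 : ℝ) 1) :=
  Set.range fun (t : Set.Ioc (0 : ℝ) 1) x => ⟨max ((x : ℝ) + t - 1) 0 / t,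
    div_nonneg (le_max_right _ _) t.2.1.le,
    (div_lt_one t.2.1).2 (max_lt (by linarith [x.2.2]) t.2.1)⟩

/-- `Φ^Po`. -/
noncomputable def phiPow : Set (Set.Ioo (0 : ℝ) 1 → Set.Ioo (0 : ℝ) 1) :=
  Set.range fun (t : Set.Ioc (0 : ℝ) 1) x => ⟨(x : ℝ) ^ (1 / (t : ℝ)),
    Real.rpow_pos_of_pos x.2.1 _,
    Real.rpow_lt_one x.2.1.le x.2.2 (one_div_pos.2 t.2.1)⟩

/-- The composition tomonoid `Φ` is Łukasiewicz. -/
def IsLukasiewicz {A : Type*} [LE A] (Φ : Set (A → A)) : Prop := CIsomorphic Φ phiLuk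

/-- The composition tomonoid `Φ` is product. -/
def IsProduct {A : Type*} [LE A] (Φ : Set (A → A)) : Prop := CIsomorphic Φ phiProd

/-- The composition tomonoid `Φ` is reversed product. -/
def IsRevProduct {A : Type*} [LE A] (Φ : Set (A → A)) : Prop := CIsomorphic Φ phiRevProd

/-- The composition tomonoid `Φ` is power. -/
def IsPower {A : Type*} [LE A] (Φ : Set (A → A)) : Prop := CIsomorphic Φ phiPow

section Coordinates

variable {L : Type*} [CommMonoid L] [LinearOrder L] [QNCTomonoid L]

/-- An identification of a product filter `F` with the tomonoid `((0,1]; ≤, ·, 1)`. -/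
abbrev ProductIso (F : TomonoidFilter L) := F.toSubmonoid ≃*o Set.Ioc (0 : ℝ) 1

/-- Unit coordinates on the `F`-class `R`: an identification of `R` with the interval `I` and a
coefficient `α > 0` such that `ρ_R(f)` is the map `r ↦ act α f r`, where `f ∈ F` is regarded as an
element of `(0,1]`. -/
structure UnitCoord {F : TomonoidFilter L} (φ : ProductIso F) (R : F.Quo) (I : Set ℝ)
    (act : ℝ → ℝ → ℝ → ℝ) where
  iso : F.cls R ≃o I
  α : ℝ
  α_pos : 0 < α
  rho_eq : ∀ (f : F.toSubmonoid) (x : F.cls R), (iso (F.rho R f x) : ℝ) = act α (φ f) (iso x)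

variable {F : TomonoidFilter L} (φ : ProductIso F) (R : F.Quo)

/-- `R = [0,1]` and `ρ_R(f) : r ↦ (r + α ln f) ∨ 0`. -/
abbrev LukCoord := UnitCoord φ R (Set.Icc 0 1) fun α f r => max (r + α * Real.log f) 0

/-- `R = (0,1]` and `ρ_R(f) : r ↦ f^α r`. -/
abbrev ProdCoord := UnitCoord φ R (Set.Ioc 0 1) fun α f r => f ^ α * r

/-- `R = [0,1)` and `ρ_R(f) : r ↦ (1 - (1 - r) / f^α) ∨ 0`. -/
abbrev RevProdCoord := UnitCoord φ R (Set.Ico 0 1) fun α f r => max (1 - (1 - r) / f ^ α) 0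

/-- `R = (0,1)` and `ρ_R(f) : r ↦ r^(1 / f^α)`. -/
abbrev PowCoord := UnitCoord φ R (Set.Ioo 0 1) fun α f r => r ^ (1 / f ^ α)

variable {φ R} {T : F.Quo} {I J : Set ℝ} {act act' : ℝ → ℝ → ℝ → ℝ}

/-- The set `Λ^{R,S}` in unit coordinates on `R` and `S`, as a set of real-valued functions on the
base set of the coordinates of `R`. -/
def LambdaIn (cR : UnitCoord φ R I act) (cS : UnitCoord φ (R * T) J act') : Set (I → ℝ) :=
  (fun g x => (cS.iso (g (cR.iso.symm x)) : ℝ)) '' F.LambdaPair R T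

end Coordinates

/-! ### Hölder's theorem for Archimedean tomonoids -/

section Hoelder

variable {M : Type*} [CommMonoid M] [LinearOrder M] [QNCTomonoid M]

/-! The idea is to take logarithms until everything becomes a translation. Hölder's theorem
(`IsArchimedeanTomonoid.nonempty_orderMonoidIso`) identifies `F` with `(0,1]`: an Archimedean `F`
without least element is cancellative and divisible downwards, so it embeds in the reals, and
density and completeness make the image all of `(-∞, 0]`.

On a class of any of the four types, the action of `F` is governed by a monotone solution of
Cauchy's equation, truncated in the Łukasiewicz case. This yields the coefficient `α`. A suitable
logarithm then gives a coordinate `G` in which `f` acts as `y ↦ tr (y + log f)`, with `tr` the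
identity or `max · 0` (`IsShiftCoord`).

Multiplication by `t ∈ T` commutes with the action of `F`. As `F` moves any element of `R` onto any
smaller one, such a map is determined below a point by its value there, and hence reads `y ↦ tr' (y
+ c)`. The exception is the constant map onto the bottom of `S`, when `S` is truncated and `R` has
no top.

The constants `c` that occur are closed downwards, since `t` may be multiplied by elements of `F`
(`lambdaIn_of_le`). If the products with some element of `R` are bounded, `⊙`-maximality and
distributivity over suprema give `T` a greatest element, hence a largest `c` (`exists_greatest`,
`lambdaIn_eq_of_bounded`); otherwise every admissible `c` occurs. The cases of the theorem are these
two outcomes, rewritten in unit coordinates. -/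

theorem IsArchimedeanTomonoid.mul_lt_self [NoMinOrder M] (h : IsArchimedeanTomonoid M) (a : M)
    {f : M} (hf : f < 1) : a * f < a := by
  have hle : a * f ≤ a := by simpa using mul_le_mul_right (QNCTomonoid.negative f) a
  refine hle.lt_of_ne fun he => ?_
  have hpow : ∀ n : ℕ, a * f ^ n = a := by
    intro n
    induction n with
    | zero => simp
    | succ n ih => rw [pow_succ, ← mul_assoc, ih, he]
  obtain ⟨c, hc⟩ := exists_lt (min a f)
  obtain ⟨n, -, hn⟩ := h c f (hc.trans_le (min_le_right _ _)) hf
  have : a ≤ c := calc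
    a = a * f ^ n := (hpow n).symm
    _ ≤ 1 * c := mul_le_mul' (QNCTomonoid.negative a) hn
    _ = c := one_mul c
  exact absurd (hc.trans_le (min_le_left _ _)) this.not_gt

/-- The residual `f`, the supremum of all `g` with `a * g ≤ b`, works. Distributivity gives `a * f ≤
b`; for the converse, powers of a `g` close to 1 approximate `f` up to one factor `g`, and that
factor disappears in the limit. -/
theorem IsArchimedeanTomonoid.exists_mul_eq [NoMinOrder M] [DenselyOrdered M]
    (h : IsArchimedeanTomonoid M) {a b : M} (hba : b ≤ a) : ∃ f, a * f = b := by
  have hb : b ∈ {g | a * g ≤ b} := by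
    simpa using mul_le_mul_left (QNCTomonoid.negative a) b
  obtain ⟨f, hf⟩ := QNCTomonoid.almostComplete {g | a * g ≤ b} ⟨b, hb⟩
  have haf : a * f ≤ b :=
    (QNCTomonoid.quantic a f _ ⟨b, hb⟩ hf).2 (by rintro _ ⟨g, hg, rfl⟩; exact hg)
  refine ⟨f, haf.antisymm ?_⟩
  rcases (QNCTomonoid.negative f).eq_or_lt with rfl | hf1
  · simpa using hba
  obtain ⟨c, hc⟩ := exists_lt (1 : M)
  -- By density 1 is the supremum of all `g < 1`, so `b` is the supremum of the `b * g`, and it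
  -- suffices to bound each of these by `a * f`.
  refine (mul_one b ▸ (QNCTomonoid.quantic b 1 (Set.Iio 1) ⟨c, hc⟩ isLUB_Iio)).2 ?_
  rintro _ ⟨g, hg, rfl⟩
  have hex : ∃ n : ℕ, g ^ n ≤ f := by
    obtain ⟨d, hd⟩ := exists_lt (min f g)
    obtain ⟨n, -, hn⟩ := h d g (hd.trans_le (min_le_right _ _)) hg
    exact ⟨n, hn.trans (hd.trans_le (min_le_left _ _)).le⟩
  classical
  -- At the first power below `f`, the preceding power is not in the set defining `f`, so `a * g ^
  -- k` still lies above `b`.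
  obtain ⟨k, hk⟩ : ∃ k, Nat.find hex = k + 1 := by
    refine Nat.exists_eq_succ_of_ne_zero fun h0 => ?_
    have := Nat.find_spec hex
    rw [h0, pow_zero] at this
    exact this.not_gt hf1
  have h1 : ¬ g ^ k ≤ f := Nat.find_min hex (by omega)
  have h2 : g ^ (k + 1) ≤ f := hk ▸ Nat.find_spec hex
  have h3 : b ≤ a * g ^ k := by
    by_contra hlt
    exact h1 (hf.1 (not_le.1 hlt).le)
  calc b * g ≤ a * g ^ k * g := mul_le_mul_left h3 g
    _ = a * g ^ (k + 1) := by rw [mul_assoc, pow_succ]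
    _ ≤ a * f := mul_le_mul_right h2 a

theorem IsArchimedeanTomonoid.mul_lt_mul [NoMinOrder M] [DenselyOrdered M]
    (h : IsArchimedeanTomonoid M) (a : M) {b c : M} (hbc : b < c) : a * b < a * c := by
  obtain ⟨f, rfl⟩ := h.exists_mul_eq hbc.le
  have hf : f < 1 := (QNCTomonoid.negative f).lt_of_ne (by rintro rfl; simp at hbc)
  rw [← mul_assoc]
  exact h.mul_lt_self _ hf

theorem IsArchimedeanTomonoid.isOrderedCancelMonoid [NoMinOrder M] [DenselyOrdered M]
    (h : IsArchimedeanTomonoid M) : IsOrderedCancelMonoid M where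
  mul_le_mul_left _ _ hab c := mul_le_mul_left hab c
  le_of_mul_le_mul_left a b c hab := by
    by_contra hlt
    exact hab.not_gt (h.mul_lt_mul a (not_le.1 hlt))

/-- An Archimedean tomonoid embeds into the additive real numbers. -/
theorem IsArchimedeanTomonoid.exists_strictMono [NoMinOrder M] [DenselyOrdered M]
    (h : IsArchimedeanTomonoid M) :
    ∃ ψ : M → ℝ, StrictMono ψ ∧ ∀ a b, ψ (a * b) = ψ a + ψ b := by
  have := h.isOrderedCancelMonoid
  let G := Algebra.GrothendieckGroup M
  let : LinearOrder G := inferInstanceAs (LinearOrder (Localization (⊤ : Submonoid M)))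
  have : IsOrderedCancelMonoid G :=
    inferInstanceAs (IsOrderedCancelMonoid (Localization (⊤ : Submonoid M)))
  -- For `q1 / q2 > 1` write `q2 = q1 * f` with `f < 1`. Once `f ^ n ≤ p2`, the `n`-th power of the
  -- quotient exceeds `1 / p2`, hence `p1 / p2`.
  have : MulArchimedean G := by
    refine ⟨fun x y hy => ?_⟩
    induction x using Localization.induction_on with | _ p
    induction y using Localization.induction_on with | _ q
    obtain ⟨p1, p2⟩ := p
    obtain ⟨q1, q2⟩ := q
    have hq : (q2 : M) < q1 := by
      rw [← Localization.mk_one] at hy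
      simpa using Localization.mk_lt_mk.1 hy
    obtain ⟨f, hf⟩ := h.exists_mul_eq hq.le
    have hf1 : f < 1 := (QNCTomonoid.negative f).lt_of_ne (by rintro rfl; simp at hf; simp [hf] at hq)
    obtain ⟨d, hd⟩ := exists_lt (min f p2)
    obtain ⟨n, -, hn⟩ := h d f (hd.trans_le (min_le_left _ _)) hf1
    refine ⟨n, ?_⟩
    rw [Localization.mk_pow]
    refine Localization.mk_le_mk.2 ?_
    have hn' : f ^ n ≤ p2 := hn.trans (hd.trans_le (min_le_right _ _)).le
    rw [SubmonoidClass.coe_pow, ← hf, mul_pow]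
    calc q1 ^ n * f ^ n * p1 ≤ q1 ^ n * p2 * 1 :=
          mul_le_mul' (mul_le_mul_right hn' _) (QNCTomonoid.negative _)
      _ = p2 * q1 ^ n := by rw [mul_one, mul_comm]
  obtain ⟨e, he⟩ := Archimedean.exists_orderAddMonoidHom_real_injective (Additive G)
  have hmono : StrictMono e := e.monotone'.strictMono_of_injective he
  refine ⟨fun m => e (Additive.ofMul (Algebra.GrothendieckGroup.of m)), fun a b hab => ?_,
    fun a b => ?_⟩
  · refine hmono (Additive.ofMul_lt.2 ?_)
    exact (Localization.mkOrderEmbedding (1 : (⊤ : Submonoid M))).strictMono hab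
  · simp [ofMul_mul]

/-- Hölder's theorem for `q.n.c.` tomonoids. -/
theorem IsArchimedeanTomonoid.nonempty_orderMonoidIso [NoMinOrder M] [DenselyOrdered M]
    (h : IsArchimedeanTomonoid M) : Nonempty (M ≃*o Set.Ioc (0 : ℝ) 1) := by
  obtain ⟨ψ, hψ, hmul⟩ := h.exists_strictMono
  have hone : ψ 1 = 0 := by simpa using hmul 1 1
  have hnonpos : ∀ a, ψ a ≤ 0 := fun a => hone ▸ hψ.monotone (QNCTomonoid.negative a)
  obtain ⟨a₀, ha₀⟩ := exists_lt (1 : M)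
  have ha₀' : ψ a₀ < 0 := hone ▸ hψ ha₀
  have hpow : ∀ (a : M) (n : ℕ), ψ (a ^ n) = n * ψ a := by
    intro a n
    induction n with
    | zero => simp [hone]
    | succ n ih => rw [pow_succ, hmul, ih]; push_cast; ring
  -- Split `a = k * f` with both factors below 1: the factor whose image is nearer to 0 has size at
  -- most half that of `ψ a`.
  have hsmall : ∀ n : ℕ, ∃ a, ψ a < 0 ∧ ψ a₀ ≤ 2 ^ n * ψ a := by
    intro n
    induction n with
    | zero => exact ⟨a₀, ha₀', by simp⟩
    | succ n ih =>
      obtain ⟨a, ha, han⟩ := ih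
      obtain ⟨k, hak, hk⟩ := exists_between (hψ.lt_iff_lt.1 (hone ▸ ha) : a < 1)
      obtain ⟨f, rfl⟩ := h.exists_mul_eq hak.le
      rw [hmul] at han
      have hk' : ψ k < 0 := hone ▸ hψ hk
      have hf' : ψ f < 0 := by have := hψ hak; rw [hmul] at this; linarith
      have h2 : (0 : ℝ) < 2 ^ n := by positivity
      rcases le_total (ψ k) (ψ f) with hle | hle
      · exact ⟨f, hf', by rw [pow_succ]; nlinarith⟩
      · exact ⟨k, hk', by rw [pow_succ]; nlinarith⟩
  have hdense : ∀ x y : ℝ, x < y → y ≤ 0 → ∃ d, x < ψ d ∧ ψ d ≤ y := by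
    intro x y hxy hy
    obtain ⟨n, hn⟩ := exists_pow_lt_of_lt_one (show 0 < (y - x) / -ψ a₀ from
      div_pos (sub_pos.2 hxy) (neg_pos.2 ha₀')) (by norm_num : (1 / 2 : ℝ) < 1)
    obtain ⟨a, ha, han⟩ := hsmall n
    have hax : -ψ a < y - x := by
      rw [lt_div_iff₀ (neg_pos.2 ha₀')] at hn
      refine lt_of_le_of_lt ?_ hn
      rw [one_div, inv_pow, inv_mul_eq_div, le_div_iff₀ (by positivity)]
      linarith
    have hk := Nat.ceil_lt_add_one (a := -y / -ψ a) (div_nonneg (by linarith) (by linarith))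
    have hk2 := Nat.le_ceil (-y / -ψ a)
    -- The powers of `a` have images spaced by less than `y - x`; this exponent is the first whose
    -- image is at most `y`.
    refine ⟨a ^ ⌈-y / -ψ a⌉₊, ?_, ?_⟩
    · rw [hpow]
      rw [← sub_lt_iff_lt_add, lt_div_iff₀ (by linarith)] at hk
      linarith
    · rw [hpow]
      rw [div_le_iff₀ (by linarith)] at hk2
      linarith
  have hsurj : ∀ y : ℝ, y ≤ 0 → ∃ a, ψ a = y := by
    intro y hy
    obtain ⟨a₁, -, ha₁⟩ := hdense (y - 1) y (by linarith) hy
    obtain ⟨s, hs⟩ := QNCTomonoid.almostComplete {a | ψ a ≤ y} ⟨a₁, ha₁⟩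
    refine ⟨s, ?_⟩
    rcases lt_trichotomy (ψ s) y with hlt | heq | hgt
    · obtain ⟨d, hd1, hd2⟩ := hdense _ _ hlt hy
      exact absurd (hψ.monotone (hs.1 hd2)) hd1.not_ge
    · exact heq
    · obtain ⟨y', hy1, hy2⟩ := exists_between hgt
      obtain ⟨d, hd1, hd2⟩ := hdense _ _ hy1 (hy2.le.trans (hnonpos s))
      have : s ≤ d := hs.2 fun a ha => hψ.le_iff_le.1 (le_trans ha hd1.le)
      exact absurd (hψ.monotone this) (hd2.trans_lt hy2).not_ge
  let g : M → Set.Ioc (0 : ℝ) 1 := fun a => ⟨Real.exp (ψ a), Real.exp_pos _,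
    Real.exp_le_one_iff.2 (hnonpos a)⟩
  have hg : StrictMono g := fun a b hab => Real.exp_lt_exp.2 (hψ hab)
  have hgs : Function.Surjective g := by
    rintro ⟨x, hx0, hx1⟩
    obtain ⟨a, ha⟩ := hsurj (Real.log x) (Real.log_nonpos hx0.le hx1)
    exact ⟨a, Subtype.ext (by simp [g, ha, Real.exp_log hx0])⟩
  exact ⟨{ toEquiv := Equiv.ofBijective g ⟨hg.injective, hgs⟩
           map_mul' := fun a b => Subtype.ext <| by
             change Real.exp (ψ (a * b)) = Real.exp (ψ a) * Real.exp (ψ b)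
             rw [hmul, Real.exp_add]
           map_le_map_iff' := hg.le_iff_le }⟩

end Hoelder

/-! ### The filter as a product tomonoid -/

namespace TomonoidFilter

variable {L : Type*} [CommMonoid L] [LinearOrder L] [QNCTomonoid L] (F : TomonoidFilter L)

/-- Upward closure makes non-empty suprema in `F` agree with those in `L`, so completeness and
distributivity are inherited. -/
instance : QNCTomonoid F.toSubmonoid where
  mul_le_mul_left a b hab c := mul_le_mul_left (α := L) hab c
  negative a := QNCTomonoid.negative (a : L)
  almostComplete s hs := by
    obtain ⟨b, hb⟩ := QNCTomonoid.almostComplete (Subtype.val '' s) (hs.image _)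
    obtain ⟨a, ha⟩ := hs
    refine ⟨⟨b, F.upward a.2 (hb.1 ⟨a, ha, rfl⟩)⟩, fun x hx => hb.1 ⟨x, hx, rfl⟩, fun x hx => ?_⟩
    refine hb.2 ?_
    rintro _ ⟨y, hy, rfl⟩
    exact hx hy
  quantic a b s hs hb := by
    have hbL : IsLUB (Subtype.val '' s) (b : L) := by
      obtain ⟨c, hc⟩ := QNCTomonoid.almostComplete (Subtype.val '' s) (hs.image _)
      obtain ⟨x, hx⟩ := hs
      have hcF : c ∈ F.toSubmonoid := F.upward x.2 (hc.1 ⟨x, hx, rfl⟩)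
      have : b ≤ ⟨c, hcF⟩ := hb.2 fun y hy => hc.1 ⟨y, hy, rfl⟩
      refine ⟨?_, fun y hy => le_trans this (hc.2 hy)⟩
      rintro _ ⟨y, hy, rfl⟩
      exact hb.1 hy
    have := QNCTomonoid.quantic (a : L) b _ (hs.image _) hbL
    refine ⟨?_, fun x hx => this.2 ?_⟩
    · rintro _ ⟨y, hy, rfl⟩
      exact mul_le_mul_right (α := L) (hb.1 hy) a
    · rintro _ ⟨_, ⟨y, hy, rfl⟩, rfl⟩
      exact hx ⟨y, hy, rfl⟩

theorem nonempty_productIso (hArch : IsArchimedeanTomonoid F.toSubmonoid) {I : Set ℝ}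
    (hI : IsRealInterval I) (e : F.cls 1 ≃o I)
    (hMin : ¬ ∃ d, IsLeast (F.toSubmonoid : Set L) d) : Nonempty (ProductIso F) := by
  have hconv : I.OrdConnected := by
    rcases hI with ⟨a, rfl⟩ | ⟨a, b, -, rfl | rfl | rfl | rfl⟩ <;> infer_instance
  have : NoMinOrder F.toSubmonoid := by
    refine ⟨fun a => ?_⟩
    by_contra! hcon
    exact hMin ⟨a, a.2, fun x hx => hcon ⟨x, hx⟩⟩
  have : DenselyOrdered F.toSubmonoid := by
    refine ⟨fun a b hab => ?_⟩
    have hcls : ∀ x : F.toSubmonoid, (x : L) ∈ F.cls 1 := fun x => F.cls_one ▸ x.2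
    have hlt : (⟨a, hcls a⟩ : F.cls 1) < ⟨b, hcls b⟩ := hab
    obtain ⟨y, hy1, hy2⟩ := exists_between (Subtype.coe_lt_coe.2 (e.lt_iff_lt.2 hlt))
    have hy : y ∈ I := hconv.out (e ⟨a, hcls a⟩).2 (e ⟨b, hcls b⟩).2 ⟨hy1.le, hy2.le⟩
    have h1 : (⟨a, hcls a⟩ : F.cls 1) < e.symm ⟨y, hy⟩ := (e.lt_symm_apply).2 hy1
    have h2 : e.symm ⟨y, hy⟩ < (⟨b, hcls b⟩ : F.cls 1) := (e.symm_apply_lt).2 hy2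
    have hF : (e.symm ⟨y, hy⟩ : L) ∈ (F.toSubmonoid : Set L) := by
      rw [← F.cls_one]
      exact (e.symm ⟨y, hy⟩).2
    exact ⟨⟨e.symm ⟨y, hy⟩, hF⟩, h1, h2⟩
  exact hArch.nonempty_orderMonoidIso

end TomonoidFilter

/-! ### Truncated Cauchy equation -/

section Cauchy

open Filter Topology

/-- Monotone solutions of the Cauchy equation on `[0, ∞)`, possibly truncated by `tr`. -/
theorem eq_tr_mul_of_monotone {tr : ℝ → ℝ} (hc : Continuous tr)
    (htr : ∀ y z, 0 ≤ y → 0 ≤ z → tr (tr y + z) = tr (y + z)) {v : ℝ → ℝ} (hv : ∀ s, 0 ≤ v s)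
    (hmono : Monotone v) (hzero : v 0 = tr 0)
    (hadd : ∀ s s', 0 ≤ s → 0 ≤ s' → v (s + s') = tr (v s + v s')) {s₀ : ℝ} (hs₀ : 0 < s₀)
    (hfix : ∀ y, tr y = v s₀ → y = v s₀) {s : ℝ} (hs : 0 ≤ s) : v s = tr (v s₀ / s₀ * s) := by
  have hn : ∀ (n : ℕ) (s : ℝ), 0 ≤ s → v (n * s) = tr (n * v s) := by
    intro n s hs
    induction n with
    | zero => simpa using hzero
    | succ n ih =>
      push_cast
      rw [add_mul, one_mul, hadd _ _ (by positivity) hs, ih,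
        htr _ _ (mul_nonneg n.cast_nonneg (hv s)) (hv s), add_mul, one_mul]
  -- `hfix` says that `v s₀` is a value reached without truncation, so here `tr` can be cancelled
  -- and the slope is exact.
  have hdiv : ∀ n : ℕ, 0 < n → v (s₀ / n) = v s₀ / n := by
    intro n hpos
    have hn0 : (n : ℝ) ≠ 0 := by positivity
    have h1 := hn n (s₀ / n) (by positivity)
    rw [mul_div_cancel₀ _ hn0] at h1
    rw [eq_div_iff hn0, mul_comm]
    exact hfix _ h1.symm
  have hrat : ∀ k n : ℕ, 0 < n → v (k * (s₀ / n)) = tr (v s₀ * (k / n)) := by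
    intro k n hpos
    rw [hn k _ (by positivity), hdiv n hpos]
    congr 1
    ring
  have hx : 0 ≤ s / s₀ := by positivity
  -- Rational multiples of `s₀` just below and just above `s` trap `v s` by monotonicity, and
  -- continuity of `tr` closes the gap.
  have hlim : Tendsto (fun n : ℕ => ((⌊s / s₀ * n⌋₊ : ℕ) : ℝ) / n) atTop (𝓝 (s / s₀)) :=
    (tendsto_nat_floor_mul_div_atTop hx).comp tendsto_natCast_atTop_atTop
  have hlim' : Tendsto (fun n : ℕ => ((⌊s / s₀ * n⌋₊ + 1 : ℕ) : ℝ) / n) atTop (𝓝 (s / s₀)) := by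
    have := hlim.add tendsto_one_div_atTop_nhds_zero_nat
    rw [add_zero] at this
    refine this.congr fun n => ?_
    push_cast
    ring
  have hsn : ∀ n : ℕ, s * n = s / s₀ * n * s₀ := fun n => by field_simp
  have key : ∀ {k : ℕ → ℕ}, Tendsto (fun n : ℕ => (k n : ℝ) / n) atTop (𝓝 (s / s₀)) →
      Tendsto (fun n => tr (v s₀ * (k n / n))) atTop (𝓝 (tr (v s₀ / s₀ * s))) := by
    intro k hk
    have := (hc.tendsto _).comp (hk.const_mul (v s₀))
    rwa [show v s₀ * (s / s₀) = v s₀ / s₀ * s by ring] at this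
  refine le_antisymm (ge_of_tendsto (key hlim') ?_) (le_of_tendsto (key hlim) ?_)
  · filter_upwards [eventually_gt_atTop 0] with n hpos
    rw [← hrat _ _ hpos]
    refine hmono ?_
    have h1 := (Nat.lt_floor_add_one (s / s₀ * n)).le
    have hn' : (0 : ℝ) < n := by exact_mod_cast hpos
    push_cast
    rw [← mul_div_assoc, le_div_iff₀ hn', hsn]
    exact mul_le_mul_of_nonneg_right h1 hs₀.le
  · filter_upwards [eventually_gt_atTop 0] with n hpos
    rw [← hrat _ _ hpos]
    refine hmono ?_
    have hn' : (0 : ℝ) < n := by exact_mod_cast hpos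
    have h1 := Nat.floor_le (show 0 ≤ s / s₀ * n by positivity)
    rw [← mul_div_assoc, div_le_iff₀ hn', hsn]
    exact mul_le_mul_of_nonneg_right h1 hs₀.le

/-- Pulled back along `s ↦ exp (-s)`, the function `u` becomes a monotone truncated-additive
function on `[0, ∞)`. A point `f₀` with positive, untruncated value makes the slope positive and
determines it. -/
theorem exists_eq_tr_mul_log {M : Type*} [CommMonoid M] [LinearOrder M]
    (φ : M ≃*o Set.Ioc (0 : ℝ) 1) {tr : ℝ → ℝ} (hc : Continuous tr)
    (htr : ∀ y z, 0 ≤ y → 0 ≤ z → tr (tr y + z) = tr (y + z)) {u : M → ℝ} (hu : ∀ f, 0 ≤ u f)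
    (hanti : Antitone u) (hone : u 1 = 0) (hzero : tr 0 = 0)
    (hmul : ∀ f g, u (f * g) = tr (u f + u g)) {f₀ : M} (hf₀ : 0 < u f₀)
    (hfix : ∀ y, tr y = u f₀ → y = u f₀) :
    ∃ α : ℝ, 0 < α ∧ ∀ f, u f = tr (-(α * Real.log (φ f))) := by
  -- The `max` only makes `E` total and antitone on the whole line; the Cauchy equation is used for
  -- `s ≥ 0`.
  let E : ℝ → Set.Ioc (0 : ℝ) 1 := fun s => ⟨Real.exp (-max s 0), Real.exp_pos _,
    Real.exp_le_one_iff.2 (neg_nonpos.2 (le_max_right _ _))⟩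
  have hEanti : Antitone E := fun a b hab =>
    Real.exp_le_exp.2 (neg_le_neg (max_le_max_right 0 hab))
  have hE : ∀ f, φ.symm (E (-Real.log (φ f))) = f := by
    intro f
    have hlog : Real.log (φ f) ≤ 0 := Real.log_nonpos (φ f).2.1.le (φ f).2.2
    have : E (-Real.log (φ f)) = φ f := by
      apply Subtype.ext
      simp only [E]
      rw [max_eq_left (by linarith), neg_neg, Real.exp_log (φ f).2.1]
    rw [this]
    exact φ.toEquiv.symm_apply_apply f
  have hE0 : E 0 = 1 := Subtype.ext (by simp [E])
  have hφ1 : φ.symm 1 = 1 := map_one φ.symm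
  have hlt : 0 < -Real.log (φ f₀) := by
    rw [neg_pos]
    refine Real.log_neg (φ f₀).2.1 ((φ f₀).2.2.lt_of_ne fun h => ?_)
    have h1 : φ f₀ = 1 := Subtype.ext h
    have h2 : f₀ = 1 := by rw [← hE f₀, h1]; simp [hE0, hφ1]
    rw [h2, hone] at hf₀
    exact hf₀.false
  have hadd : ∀ s s', 0 ≤ s → 0 ≤ s' → E (s + s') = E s * E s' := by
    intro s s' hs hs'
    apply Subtype.ext
    simp only [E, Set.Ioc.coe_mul]
    rw [max_eq_left hs, max_eq_left hs', max_eq_left (add_nonneg hs hs'), ← Real.exp_add]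
    congr 1
    ring
  have hsymm : Monotone φ.symm := fun a b hab => φ.toOrderIso.symm.monotone hab
  refine ⟨u f₀ / -Real.log (φ f₀), div_pos hf₀ hlt, fun f => ?_⟩
  have := eq_tr_mul_of_monotone (v := fun s => u (φ.symm (E s))) hc htr (fun s => hu _)
    (fun a b hab => hanti (hsymm (hEanti hab))) (by simp [hE0, hφ1, hone, hzero])
    (fun s s' hs hs' => by rw [hadd s s' hs hs', map_mul, hmul]) hlt
    (by simpa only [hE] using hfix)
    (s := -Real.log (φ f)) (neg_nonneg.2 (Real.log_nonpos (φ f).2.1.le (φ f).2.2))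
  simp only [hE] at this
  rw [this, mul_neg]

end Cauchy

/-! ### Existence of unit coordinates -/

namespace TomonoidFilter

variable {L : Type*} [CommMonoid L] [LinearOrder L] [QNCTomonoid L] {F : TomonoidFilter L}

theorem rho_one (R : F.Quo) (x : F.cls R) : F.rho R 1 x = x := Subtype.ext (one_mul _)

theorem rho_mul (R : F.Quo) (f g : F.toSubmonoid) (x : F.cls R) :
    F.rho R (f * g) x = F.rho R f (F.rho R g x) := Subtype.ext (mul_assoc _ _ _)

theorem rho_le_rho (R : F.Quo) {f g : F.toSubmonoid} (h : f ≤ g) (x : F.cls R) :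
    F.rho R f x ≤ F.rho R g x := mul_le_mul_left (α := L) h x

theorem exists_of_cIsomorphic {R : F.Quo} {B ι : Type*} [LE B] {Q : ι → B → B}
    (h : CIsomorphic (F.LambdaCls R) (Set.range Q)) :
    ∃ ψ : F.cls R ≃o B, (∀ f, ∃ i, ∀ x, ψ (F.rho R f x) = Q i (ψ x)) ∧
      ∀ i, ∃ f, ∀ x, ψ (F.rho R f x) = Q i (ψ x) := by
  obtain ⟨ψ, hψ⟩ := h
  refine ⟨ψ, fun f => ?_, fun i => ?_⟩
  · obtain ⟨i, hi⟩ : ψ ∘ F.rho R f ∘ ψ.symm ∈ Set.range Q := hψ ▸ ⟨_, ⟨f, rfl⟩, rfl⟩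
    exact ⟨i, fun x => by simp [hi]⟩
  · have hi : Q i ∈ Set.range Q := ⟨i, rfl⟩
    rw [hψ] at hi
    obtain ⟨_, ⟨f, rfl⟩, hf⟩ := hi
    exact ⟨f, fun x => by simp [← hf]⟩

/-- The parameter of the map `ρ_R(f)` is a monotone homomorphism from `F` to `(0,1]`, thus a power
of `φ f`. The hypotheses on `Q` are what the product, reversed product and power families have in
common: faithfulness comes from reflecting the pointwise order. -/
theorem exists_rpow_of_cIsomorphic (φ : ProductIso F) {R : F.Quo} {B : Type*} [PartialOrder B]
    {Q : Set.Ioc (0 : ℝ) 1 → B → B} (hmul : ∀ a b x, Q (a * b) x = Q a (Q b x))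
    (hle : ∀ a b, (∀ x, Q a x ≤ Q b x) → a ≤ b)
    (h : CIsomorphic (F.LambdaCls R) (Set.range Q)) :
    ∃ ψ : F.cls R ≃o B, ∃ α : ℝ, 0 < α ∧ ∀ f x, ∃ a : Set.Ioc (0 : ℝ) 1,
      (a : ℝ) = (φ f : ℝ) ^ α ∧ ψ (F.rho R f x) = Q a (ψ x) := by
  obtain ⟨ψ, ht, hs⟩ := exists_of_cIsomorphic h
  choose t ht using ht
  have hinj : ∀ a b, (∀ x, Q a (ψ x) = Q b (ψ x)) → a = b := fun a b hab =>
    le_antisymm (hle a b fun y => by simpa using (hab (ψ.symm y)).le)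
      (hle b a fun y => by simpa using (hab (ψ.symm y)).ge)
  have htmul : ∀ f g, t (f * g) = t f * t g := fun f g => hinj _ _ fun x => by
    rw [← ht, rho_mul, ht, ht, hmul]
  have htone : (t 1 : ℝ) = 1 := by
    have h1 := congrArg Subtype.val (htmul 1 1)
    rw [mul_one, Set.Ioc.coe_mul] at h1
    exact (mul_eq_left₀ (t 1).2.1.ne').1 h1.symm
  have htmono : Monotone t := fun f g hfg => hle _ _ fun y => by
    obtain ⟨x, rfl⟩ := ψ.surjective y
    rw [← ht, ← ht]
    exact ψ.monotone (rho_le_rho R hfg x)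
  -- Some element acts with parameter `exp (-1)`, so the homomorphism is not constant and `α` is
  -- positive.
  obtain ⟨f₀, hf₀⟩ := hs ⟨Real.exp (-1), Real.exp_pos _, by simp⟩
  have hf₀' := hinj _ _ fun x => (ht f₀ x).symm.trans (hf₀ x)
  obtain ⟨α, hα, hu⟩ := exists_eq_tr_mul_log φ (tr := id) (u := fun f => -Real.log (t f))
    continuous_id (fun _ _ _ _ => rfl)
    (fun f => neg_nonneg.2 (Real.log_nonpos (t f).2.1.le (t f).2.2))
    (fun f g hfg => neg_le_neg (Real.log_le_log (t f).2.1 (htmono hfg))) (by simp [htone]) rfl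
    (fun f g => by
      simp only [htmul, Set.Ioc.coe_mul, id]
      rw [Real.log_mul (t f).2.1.ne' (t g).2.1.ne', neg_add])
    (f₀ := f₀) (by simp [hf₀']) (fun y hy => hy)
  refine ⟨ψ, α, hα, fun f x => ⟨t f, ?_, ht f x⟩⟩
  have := hu f
  simp only [id, neg_inj] at this
  rw [Real.rpow_def_of_pos (φ f).2.1, mul_comm, ← this, Real.exp_log (t f).2.1]

theorem nonempty_prodCoord (φ : ProductIso F) {R : F.Quo} (h : IsProduct (F.LambdaCls R)) :
    Nonempty (ProdCoord φ R) := by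
  obtain ⟨ψ, α, hα, hψ⟩ := exists_rpow_of_cIsomorphic φ
    (fun a b x => Subtype.ext (by simp [mul_assoc]))
    (fun a b hab => by
      have := hab ⟨1, one_pos, le_rfl⟩
      rw [← Subtype.coe_le_coe] at this
      simpa using this) h
  refine ⟨⟨ψ, α, hα, fun f x => ?_⟩⟩
  obtain ⟨a, ha, hax⟩ := hψ f x
  rw [hax, ← ha]

theorem nonempty_powCoord (φ : ProductIso F) {R : F.Quo} (h : IsPower (F.LambdaCls R)) :
    Nonempty (PowCoord φ R) := by
  obtain ⟨ψ, α, hα, hψ⟩ := exists_rpow_of_cIsomorphic φ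
    (fun a b x => Subtype.ext (by
      change (x : ℝ) ^ (1 / ((a : ℝ) * b)) = ((x : ℝ) ^ (1 / (b : ℝ))) ^ (1 / (a : ℝ))
      rw [← Real.rpow_mul x.2.1.le]
      congr 1
      have := a.2.1.ne'
      have := b.2.1.ne'
      field_simp))
    (fun a b hab => by
      have := hab ⟨Real.exp (-1), Real.exp_pos _, by simp⟩
      rw [← Subtype.coe_le_coe] at this
      simp only [← Real.exp_mul, Real.exp_le_exp] at this
      rw [← Subtype.coe_le_coe]
      exact (one_div_le_one_div b.2.1 a.2.1).1 (by linarith)) h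
  refine ⟨⟨ψ, α, hα, fun f x => ?_⟩⟩
  obtain ⟨a, ha, hax⟩ := hψ f x
  rw [hax, ← ha]

theorem max_sub_div_eq {x t : ℝ} (ht : 0 < t) :
    max (x + t - 1) 0 / t = max (1 - (1 - x) / t) 0 := by
  rw [← max_div_div_right ht.le, zero_div]
  congr 1
  field_simp
  ring

theorem nonempty_revProdCoord (φ : ProductIso F) {R : F.Quo} (h : IsRevProduct (F.LambdaCls R)) :
    Nonempty (RevProdCoord φ R) := by
  obtain ⟨ψ, α, hα, hψ⟩ := exists_rpow_of_cIsomorphic φ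
    (fun a b x => Subtype.ext (by
      change max ((x : ℝ) + a * b - 1) 0 / (a * b) =
        max (max ((x : ℝ) + b - 1) 0 / b + a - 1) 0 / a
      have ha := a.2.1
      have hb := b.2.1
      rw [max_sub_div_eq ha, max_sub_div_eq hb, max_sub_div_eq (mul_pos ha hb),
        mul_comm, ← div_div]
      rcases le_total (1 - (1 - (x : ℝ)) / b) 0 with h0 | h0
      · rw [max_eq_right h0, max_eq_right, max_eq_right]
        · rw [sub_zero, sub_nonpos]
          exact (one_le_div ha).2 a.2.2
        · rw [sub_nonpos, one_le_div ha]
          exact a.2.2.trans (by linarith)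
      · rw [max_eq_left h0, sub_sub_cancel]))
    (fun a b hab => by
      have ha := a.2.1
      have hb := b.2.1
      have hab0 := mul_pos ha hb
      have hab1 : (a : ℝ) * b ≤ 1 := mul_le_one₀ a.2.2 hb.le b.2.2
      -- At this point neither truncation is active: the values are `1 - b / 2` and `1 - a / 2`.
      have := hab ⟨1 - a * b / 2, by linarith, by linarith⟩
      rw [← Subtype.coe_le_coe] at this
      simp only [max_sub_div_eq ha, max_sub_div_eq hb, sub_sub_cancel] at this
      rw [show (a : ℝ) * b / 2 / a = b / 2 by field_simp,
        show (a : ℝ) * b / 2 / b = a / 2 by field_simp,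
        max_eq_left (by linarith [b.2.2]), max_eq_left (by linarith [a.2.2])] at this
      rw [← Subtype.coe_le_coe]
      linarith) h
  refine ⟨⟨ψ, α, hα, fun f x => ?_⟩⟩
  obtain ⟨a, ha, hax⟩ := hψ f x
  rw [hax, ← ha]
  exact max_sub_div_eq a.2.1

/-- Here the parameter can be 0, so its logarithm is unavailable. The loss `1 - t f` is used
instead; it is additive up to truncation at 1. -/
theorem nonempty_lukCoord (φ : ProductIso F) {R : F.Quo} (h : IsLukasiewicz (F.LambdaCls R)) :
    Nonempty (LukCoord φ R) := by
  obtain ⟨ψ, ht, hs⟩ := exists_of_cIsomorphic h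
  choose t ht using ht
  have ht' : ∀ f x, (ψ (F.rho R f x) : ℝ) = max ((ψ x : ℝ) + t f - 1) 0 := fun f x =>
    congrArg Subtype.val (ht f x)
  have htop : ∀ f, (ψ (F.rho R f (ψ.symm 1)) : ℝ) = t f := fun f => by
    rw [ht', ψ.apply_symm_apply]
    simp [(t f).2.1]
  -- The loss 1/2 is positive and strictly below the cap 1, so it can be attained only without
  -- truncation.
  obtain ⟨f₀, hf₀⟩ := hs ⟨1 / 2, by norm_num, by norm_num⟩
  have hf₀' : (t f₀ : ℝ) = 1 / 2 := by
    rw [← htop, hf₀, ψ.apply_symm_apply]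
    norm_num
  obtain ⟨α, hα, hu⟩ := exists_eq_tr_mul_log φ (tr := fun y => min y 1)
    (u := fun f => 1 - (t f : ℝ)) (by fun_prop)
    (fun y z hy hz => by
      rcases le_total y 1 with h1 | h1
      · rw [min_eq_left h1]
      · rw [min_eq_right h1, min_eq_right (by linarith), min_eq_right (by linarith)])
    (fun f => sub_nonneg.2 (t f).2.2)
    (fun f g hfg => by
      simp only [← htop]
      exact sub_le_sub_left (Subtype.coe_le_coe.2 (ψ.monotone (rho_le_rho R hfg _))) 1)
    (by simp [← htop, rho_one]) (by simp)
    (fun f g => by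
      rw [← htop, rho_mul, ht', htop]
      rcases le_total ((t g : ℝ) + t f - 1) 0 with h1 | h1
      · rw [max_eq_right h1, min_eq_right (by linarith)]; ring
      · rw [max_eq_left h1, min_eq_left (by linarith)]; ring)
    (f₀ := f₀) (by norm_num [hf₀'])
    (fun y hy => by
      rw [hf₀'] at hy ⊢
      rcases min_choice y 1 with h1 | h1 <;> rw [h1] at hy
      · exact hy
      · norm_num at hy)
  refine ⟨⟨ψ, α, hα, fun f x => ?_⟩⟩
  have hx := (ψ x).2.2
  have := hu f
  rw [ht']
  rcases le_total (-(α * Real.log (φ f))) 1 with h1 | h1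
  · rw [min_eq_left h1] at this
    congr 1
    linarith
  · rw [min_eq_right h1] at this
    rw [max_eq_right (by linarith), max_eq_right (by linarith)]

end TomonoidFilter

/-! ### Shift coordinates and the maps between classes -/

namespace TomonoidFilter

variable {L : Type*} [CommMonoid L] [LinearOrder L] [QNCTomonoid L] {F : TomonoidFilter L}

/-- A coordinate on a class in which `F` acts by translations, truncated by `tr`. -/
structure IsShiftCoord (φ : ProductIso F) (R : F.Quo) (tr : ℝ → ℝ) (G : F.cls R → ℝ) : Prop where
  strictMono : StrictMono G
  map_rho : ∀ f x, G (F.rho R f x) = tr (G x + Real.log (φ f))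

theorem lambdaMap_rho (R T : F.Quo) (t : F.cls T) (f : F.toSubmonoid) (x : F.cls R) :
    F.lambdaMap R T t (F.rho R f x) = F.rho (R * T) f (F.lambdaMap R T t x) :=
  Subtype.ext (mul_left_comm _ _ _)

theorem lambdaMap_rho_left (R T : F.Quo) (t : F.cls T) (f : F.toSubmonoid) (x : F.cls R) :
    F.lambdaMap R T (F.rho T f t) x = F.rho (R * T) f (F.lambdaMap R T t x) :=
  Subtype.ext (mul_assoc _ _ _)

theorem lambdaMap_le_lambdaMap (R T : F.Quo) {t t' : F.cls T} (h : t ≤ t') (x : F.cls R) :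
    F.lambdaMap R T t x ≤ F.lambdaMap R T t' x := mul_le_mul_left (α := L) h x

theorem lambdaMap_mono (R T : F.Quo) (t : F.cls T) : Monotone (F.lambdaMap R T t) :=
  fun _ _ h => mul_le_mul_right (α := L) h t

theorem cls_nonempty (R : F.Quo) : Nonempty (F.cls R) := by
  obtain ⟨a, ha⟩ := F.toQuo_surj R
  exact ⟨⟨a, ha⟩⟩

omit [QNCTomonoid L] in
theorem exists_log_eq (φ : ProductIso F) {s : ℝ} (hs : s ≤ 0) : ∃ f, Real.log (φ f) = s :=
  ⟨φ.symm ⟨Real.exp s, Real.exp_pos _, Real.exp_le_one_iff.2 hs⟩, by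
    rw [show φ (φ.symm ⟨Real.exp s, Real.exp_pos _, Real.exp_le_one_iff.2 hs⟩) = _ from
      φ.toEquiv.apply_symm_apply _, Real.log_exp]⟩

theorem exists_rho_le {R : F.Quo} (x y : F.cls R) : ∃ f, F.rho R f x ≤ y := by
  obtain ⟨f, hf, hle⟩ := ((F.rel_iff y x).1 ((F.toQuo_eq _ _).1 (y.2.trans x.2.symm))).1
  exact ⟨⟨f, hf⟩, show f * (x : L) ≤ y by rwa [mul_comm]⟩

/-- If the products of `T` with one element of `R` are bounded in `R ⊙ T`, then `T` has a greatest
element. -/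
theorem exists_greatest {R T : F.Quo} (hRT : IsOdotMaximal R T) {r : F.cls R}
    {s : F.cls (R * T)} (h : ∀ t, F.lambdaMap R T t r ≤ s) : ∃ t₁ : F.cls T, ∀ t, t ≤ t₁ := by
  obtain ⟨t₀⟩ := cls_nonempty T
  obtain ⟨b, hb⟩ := QNCTomonoid.almostComplete (F.cls T) ⟨t₀, t₀.2⟩
  have hmono : ∀ {x y : L}, x ≤ y → F.toQuo x ≤ F.toQuo y := fun {x y} hxy => ⟨x, y, rfl, rfl, hxy⟩
  -- Distributivity keeps the supremum `b` of `T` under the bound, so the class of `b` still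
  -- multiplies `R` to `R * T`, and maximality of `T` forces `b` into `T`.
  have hrb : (r : L) * b ≤ s := by
    refine (QNCTomonoid.quantic (r : L) b _ ⟨t₀, t₀.2⟩ hb).2 ?_
    rintro _ ⟨t, ht, rfl⟩
    have : t * (r : L) ≤ s := h ⟨t, ht⟩
    rwa [mul_comm] at this
  have hr : F.toQuo r = R := r.2
  have ht₀ : F.toQuo t₀ = T := t₀.2
  have hs : F.toQuo s = R * T := s.2
  have h1 : R * F.toQuo b ≤ R * T := by
    have := hmono hrb
    rwa [toQuo_mul, hr, hs] at this
  have h2 : R * T ≤ R * F.toQuo b := by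
    have := hmono (mul_le_mul_right (hb.1 t₀.2) (r : L))
    rwa [toQuo_mul, toQuo_mul, hr, ht₀] at this
  have h3 : F.toQuo b = T := le_antisymm (hRT.2.2 (h1.antisymm h2)) (ht₀ ▸ hmono (hb.1 t₀.2))
  exact ⟨⟨b, h3⟩, fun t => hb.1 t.2⟩

section Shift

variable {φ : ProductIso F} {R T : F.Quo} {tr tr' : ℝ → ℝ} {G : F.cls R → ℝ}
  {H : F.cls (R * T) → ℝ}

/-- The required shift `G x - G y` is at most 0 and so is realized by some `f`. No truncation
interferes, because acting by 1 shows that `tr` fixes every value of `G`. -/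
theorem IsShiftCoord.exists_rho_eq (hG : IsShiftCoord φ R tr G) {x y : F.cls R} (h : x ≤ y) :
    ∃ f, F.rho R f y = x ∧ Real.log (φ f) = G x - G y := by
  obtain ⟨f, hf⟩ := exists_log_eq φ (sub_nonpos.2 (hG.strictMono.monotone h))
  refine ⟨f, hG.strictMono.injective ?_, hf⟩
  have := hG.map_rho 1 x
  rw [rho_one, show φ 1 = 1 from map_one φ, Set.Ioc.coe_one, Real.log_one, add_zero] at this
  rw [hG.map_rho, hf, add_sub_cancel, ← this]

/-- Write `x` as a shift of `y` by some `f ∈ F` and use that multiplication by `t` commutes with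
`f`: the value at `y` determines all values below it. -/
theorem IsShiftCoord.lambdaMap_of_le (hG : IsShiftCoord φ R tr G)
    (hH : IsShiftCoord φ (R * T) tr' H) (t : F.cls T) {x y : F.cls R} (h : x ≤ y) :
    H (F.lambdaMap R T t x) = tr' (G x + (H (F.lambdaMap R T t y) - G y)) := by
  obtain ⟨f, rfl, hf⟩ := hG.exists_rho_eq h
  rw [lambdaMap_rho, hH.map_rho, hf]
  congr 1
  ring

theorem IsShiftCoord.lambdaMap_id (hG : IsShiftCoord φ R tr G)
    (hH : IsShiftCoord φ (R * T) id H) (t : F.cls T) :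
    ∃ c, ∀ x, H (F.lambdaMap R T t x) = id (G x + c) := by
  obtain ⟨x₀⟩ := cls_nonempty R
  refine ⟨H (F.lambdaMap R T t x₀) - G x₀, fun x => ?_⟩
  rcases le_total x x₀ with h | h
  · exact hG.lambdaMap_of_le hH t h
  · have := hG.lambdaMap_of_le hH t h
    simp only [id] at this ⊢
    linarith

/-- A map that takes a non-zero value somewhere is a truncated translation. -/
theorem IsShiftCoord.lambdaMap_max (hG : IsShiftCoord φ R tr G)
    (hH : IsShiftCoord φ (R * T) (max · 0) H) (t : F.cls T) {x₀ : F.cls R}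
    (hx₀ : 0 < H (F.lambdaMap R T t x₀)) :
    ∃ c, ∀ x, H (F.lambdaMap R T t x) = max (G x + c) 0 := by
  refine ⟨H (F.lambdaMap R T t x₀) - G x₀, fun x => ?_⟩
  rcases le_total x x₀ with h | h
  · exact hG.lambdaMap_of_le hH t h
  · have h1 := hG.lambdaMap_of_le hH t h
    have h2 := hH.strictMono.monotone (lambdaMap_mono R T t h)
    -- Above `x₀`, the formula is read backwards: positivity at `x₀` excludes truncation, so the
    -- value at `x` can be solved for.
    rcases max_choice (G x₀ + (H (F.lambdaMap R T t x) - G x)) 0 with h3 | h3 <;> rw [h3] at h1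
    · rw [max_eq_left] <;> linarith
    · linarith

theorem IsShiftCoord.nonneg (hH : IsShiftCoord φ R (max · 0) G) (x : F.cls R) : 0 ≤ G x := by
  rw [← rho_one R x, hH.map_rho]
  exact le_max_right _ _

/-- The value at the least element of `R` is the least element of `R ⊙ T`. -/
theorem IsShiftCoord.lambdaMap_of_eq_zero (hG : IsShiftCoord φ R (max · 0) G)
    (hH : IsShiftCoord φ (R * T) (max · 0) H) (t : F.cls T) {x : F.cls R} (hx : G x = 0) :
    H (F.lambdaMap R T t x) = 0 := by
  have h0 := hH.nonneg (F.lambdaMap R T t x)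
  obtain ⟨f, hf⟩ := exists_log_eq φ (neg_nonpos.2 h0)
  -- This `f` is chosen to push the image down to 0, yet it fixes the bottom `x`; so the image was 0
  -- already.
  have hfix : F.rho R f x = x := hG.strictMono.injective (by
    rw [hG.map_rho, hf, hx, max_eq_right (by linarith)])
  have := hH.map_rho f (F.lambdaMap R T t x)
  rwa [← lambdaMap_rho, hfix, hf, add_neg_cancel, max_self] at this

/-- One map with a positive value forces all maps to have one: every `t` dominates some `f * t₁`,
whose map is again a truncated translation and becomes positive far up, as `G` is unbounded above.
-/
theorem IsShiftCoord.isTrivialPair_or (hG : IsShiftCoord φ R tr G)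
    (hH : IsShiftCoord φ (R * T) (max · 0) H) (hGtop : ∀ y, ∃ x, y < G x)
    {p : F.cls (R * T)} (hp : H p = 0) :
    F.IsTrivialPair R T ∨ ∀ t, ∃ c, ∀ x, H (F.lambdaMap R T t x) = max (G x + c) 0 := by
  by_cases h : ∀ t x, H (F.lambdaMap R T t x) = 0
  · left
    refine ⟨p, fun s => hH.strictMono.le_iff_le.1 (hp ▸ hH.nonneg s), ?_⟩
    have hc : ∀ t, F.lambdaMap R T t = fun _ => p := fun t =>
      funext fun x => hH.strictMono.injective (by rw [h, hp])
    have := cls_nonempty T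
    rw [LambdaPair, funext hc, Set.range_const]
  · right
    push Not at h
    obtain ⟨t₁, x₁, h1⟩ := h
    obtain ⟨c, hc⟩ := hG.lambdaMap_max hH t₁ ((hH.nonneg _).lt_of_ne h1.symm)
    intro t
    obtain ⟨f, hf⟩ := exists_rho_le t₁ t
    obtain ⟨x, hx⟩ := hGtop (-c - Real.log (φ f))
    refine hG.lambdaMap_max hH t (x₀ := x) (lt_of_lt_of_le ?_
      (hH.strictMono.monotone (lambdaMap_le_lambdaMap R T hf x)))
    rw [lambdaMap_rho_left, hH.map_rho, hc]
    refine lt_max_of_lt_left ?_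
    have := le_max_left (G x + c) 0
    linarith

variable {I J : Set ℝ} {act act' : ℝ → ℝ → ℝ → ℝ}

theorem mem_lambdaIn_iff (cR : UnitCoord φ R I act) (cS : UnitCoord φ (R * T) J act') {q : ℝ → ℝ}
    (hq : ∀ s, (cS.iso s : ℝ) = q (H s)) {k : I → ℝ} : k ∈ LambdaIn cR cS ↔
    ∃ t, ∀ r, k r = q (H (F.lambdaMap R T t (cR.iso.symm r))) := by
  constructor
  · rintro ⟨_, ⟨t, rfl⟩, rfl⟩
    exact ⟨t, fun r => hq _⟩
  · rintro ⟨t, ht⟩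
    exact ⟨_, ⟨t, rfl⟩, funext fun r => ((ht r).trans (hq _).symm).symm⟩

/-- Constants are closed downwards: multiplying `t` by the `f` with logarithm `c' - c` lowers the
constant, and `htr` merges the two truncations. -/
theorem lambdaIn_of_le (cR : UnitCoord φ R I act) (cS : UnitCoord φ (R * T) J act') {q : ℝ → ℝ}
    (hq : ∀ s, (cS.iso s : ℝ) = q (H s)) (hH : IsShiftCoord φ (R * T) tr' H)
    (htr : ∀ y l, l ≤ 0 → tr' (tr' y + l) = tr' (y + l)) {t : F.cls T} {c c' : ℝ}
    (ht : ∀ x, H (F.lambdaMap R T t x) = tr' (G x + c)) (hc : c' ≤ c) {k : I → ℝ}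
    (hk : ∀ r, k r = q (tr' (G (cR.iso.symm r) + c'))) : k ∈ LambdaIn cR cS := by
  obtain ⟨f, hf⟩ := exists_log_eq φ (sub_nonpos.2 hc)
  refine (mem_lambdaIn_iff cR cS hq).2 ⟨F.rho T f t, fun r => ?_⟩
  rw [hk, lambdaMap_rho_left, hH.map_rho, ht, hf, htr _ _ (sub_nonpos.2 hc)]
  congr 2
  ring

/-- The set `Λ^{R,S}` if the products of `T` with some element of `R` are bounded. The maps are
parametrized by translations subject to a normalization `N`. -/
theorem lambdaIn_eq_of_bounded (hRT : IsOdotMaximal R T) (cR : UnitCoord φ R I act)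
    (cS : UnitCoord φ (R * T) J act') {q : ℝ → ℝ} (hq : ∀ s, (cS.iso s : ℝ) = q (H s))
    (hH : IsShiftCoord φ (R * T) tr' H) (htr : ∀ y l, l ≤ 0 → tr' (tr' y + l) = tr' (y + l))
    {N : ℝ → Prop} {x₀ : F.cls R}
    (hN : ∀ c c', N c → N c' → tr' (G x₀ + c) ≤ tr' (G x₀ + c') → c ≤ c')
    (hform : ∀ t, ∃ c, N c ∧ ∀ x, H (F.lambdaMap R T t x) = tr' (G x + c))
    (hbdd : ∃ r s, ∀ t, F.lambdaMap R T t r ≤ s) :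
    ∃ t M, N M ∧ (∀ x, H (F.lambdaMap R T t x) = tr' (G x + M)) ∧ LambdaIn cR cS =
      {k | ∃ c, N c ∧ c ≤ M ∧ ∀ r, k r = q (tr' (G (cR.iso.symm r) + c))} := by
  obtain ⟨r, s, hrs⟩ := hbdd
  obtain ⟨t₁, ht₁⟩ := exists_greatest hRT hrs
  obtain ⟨M, hNM, hM⟩ := hform t₁
  refine ⟨t₁, M, hNM, hM, Set.ext fun k => ⟨fun hk => ?_, ?_⟩⟩
  · obtain ⟨t, ht⟩ := (mem_lambdaIn_iff cR cS hq).1 hk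
    obtain ⟨c, hNc, hc⟩ := hform t
    -- Evaluation at `x₀` recovers the order of normalized constants from the order of the maps.
    refine ⟨c, hNc, hN c M hNc hNM ?_, fun r => by rw [ht, hc]⟩
    rw [← hc, ← hM]
    exact hH.strictMono.monotone (lambdaMap_le_lambdaMap R T (ht₁ t) x₀)
  · rintro ⟨c, -, hcM, hk⟩
    exact lambdaIn_of_le cR cS hq hH htr hM hcM hk

/-- Any constant is exceeded by that of some `t`, since the products with `x₀` are unbounded;
downward closure then reaches it. -/
theorem lambdaIn_eq_of_unbounded (cR : UnitCoord φ R I act)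
    (cS : UnitCoord φ (R * T) J act') {q : ℝ → ℝ} (hq : ∀ s, (cS.iso s : ℝ) = q (H s))
    (hH : IsShiftCoord φ (R * T) tr' H) (htr : ∀ y l, l ≤ 0 → tr' (tr' y + l) = tr' (y + l))
    {N : ℝ → Prop} {x₀ : F.cls R}
    (hN : ∀ c c', N c → N c' → tr' (G x₀ + c) ≤ tr' (G x₀ + c') → c ≤ c')
    (hform : ∀ t, ∃ c, N c ∧ ∀ x, H (F.lambdaMap R T t x) = tr' (G x + c))
    (hHtop : ∀ y, ∃ s, y ≤ H s) (hbdd : ¬ ∃ r s, ∀ t, F.lambdaMap R T t r ≤ s) :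
    LambdaIn cR cS = {k | ∃ c, N c ∧ ∀ r, k r = q (tr' (G (cR.iso.symm r) + c))} := by
  push Not at hbdd
  refine Set.ext fun k => ⟨fun hk => ?_, ?_⟩
  · obtain ⟨t, ht⟩ := (mem_lambdaIn_iff cR cS hq).1 hk
    obtain ⟨c, hNc, hc⟩ := hform t
    exact ⟨c, hNc, fun r => by rw [ht, hc]⟩
  · rintro ⟨c, hNc, hk⟩
    obtain ⟨s, hs⟩ := hHtop (tr' (G x₀ + c))
    obtain ⟨t, ht⟩ := hbdd x₀ s
    obtain ⟨c', hNc', hc'⟩ := hform t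
    refine lambdaIn_of_le cR cS hq hH htr hc' (hN c c' hNc hNc' ?_) hk
    rw [← hc']
    exact hs.trans (hH.strictMono ht).le

/-- With a top `x₀`, the value there determines the whole map. The bound `-G x₀` makes `c` unique;
it is attained by the constant zero map, which thus needs no separate treatment. -/
theorem IsShiftCoord.exists_normalized (hG : IsShiftCoord φ R tr G)
    (hH : IsShiftCoord φ (R * T) (max · 0) H) {x₀ : F.cls R} (hx₀ : ∀ x, x ≤ x₀) (t : F.cls T) :
    ∃ c, -G x₀ ≤ c ∧ ∀ x, H (F.lambdaMap R T t x) = max (G x + c) 0 :=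
  ⟨H (F.lambdaMap R T t x₀) - G x₀, by linarith [hH.nonneg (F.lambdaMap R T t x₀)],
    fun x => hG.lambdaMap_of_le hH t (hx₀ x)⟩

theorem max_add_max_zero (y l : ℝ) (hl : l ≤ 0) : max (max y 0 + l) 0 = max (y + l) 0 := by
  rcases le_total y 0 with h | h
  · rw [max_eq_right h, max_eq_right (by linarith), max_eq_right (by linarith)]
  · rw [max_eq_left h]

theorem le_of_max_add_le {a c c' : ℝ} (hc : -a ≤ c) (hc' : -a ≤ c')
    (h : max (a + c) 0 ≤ max (a + c') 0) : c ≤ c' := by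
  rw [max_eq_left (by linarith), max_eq_left (by linarith)] at h
  linarith

theorem IsShiftCoord.lambdaIn_max_of_bounded (hG : IsShiftCoord φ R tr G)
    (hH : IsShiftCoord φ (R * T) (max · 0) H) (hRT : IsOdotMaximal R T) (cR : UnitCoord φ R I act)
    (cS : UnitCoord φ (R * T) J act') (q : ℝ → ℝ) (hq : ∀ s, (cS.iso s : ℝ) = q (H s))
    {x₀ : F.cls R} (hx₀ : ∀ x, x ≤ x₀) (hbdd : ∃ r s, ∀ t, F.lambdaMap R T t r ≤ s) :
    ∃ t M, -G x₀ ≤ M ∧ (∀ x, H (F.lambdaMap R T t x) = max (G x + M) 0) ∧ LambdaIn cR cS =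
      {k | ∃ c, -G x₀ ≤ c ∧ c ≤ M ∧ ∀ r, k r = q (max (G (cR.iso.symm r) + c) 0)} :=
  lambdaIn_eq_of_bounded (N := fun c => -G x₀ ≤ c) hRT cR cS hq hH max_add_max_zero
    (fun _ _ => le_of_max_add_le) (hG.exists_normalized hH hx₀) hbdd

theorem IsShiftCoord.lambdaIn_max_of_unbounded (hG : IsShiftCoord φ R tr G)
    (hH : IsShiftCoord φ (R * T) (max · 0) H) (cR : UnitCoord φ R I act)
    (cS : UnitCoord φ (R * T) J act') (q : ℝ → ℝ) (hq : ∀ s, (cS.iso s : ℝ) = q (H s))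
    {x₀ : F.cls R} (hx₀ : ∀ x, x ≤ x₀) (hHtop : ∀ y, ∃ s, y ≤ H s)
    (hbdd : ¬ ∃ r s, ∀ t, F.lambdaMap R T t r ≤ s) :
    LambdaIn cR cS = {k | ∃ c, -G x₀ ≤ c ∧ ∀ r, k r = q (max (G (cR.iso.symm r) + c) 0)} :=
  lambdaIn_eq_of_unbounded (N := fun c => -G x₀ ≤ c) cR cS hq hH max_add_max_zero
    (fun _ _ => le_of_max_add_le) (hG.exists_normalized hH hx₀) hHtop hbdd

theorem IsShiftCoord.lambdaIn_id_of_bounded (hG : IsShiftCoord φ R tr G)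
    (hH : IsShiftCoord φ (R * T) id H) (hRT : IsOdotMaximal R T) (cR : UnitCoord φ R I act)
    (cS : UnitCoord φ (R * T) J act') (q : ℝ → ℝ) (hq : ∀ s, (cS.iso s : ℝ) = q (H s))
    (hbdd : ∃ r s, ∀ t, F.lambdaMap R T t r ≤ s) :
    ∃ t M, (∀ x, H (F.lambdaMap R T t x) = G x + M) ∧ LambdaIn cR cS =
      {k | ∃ c ≤ M, ∀ r, k r = q (G (cR.iso.symm r) + c)} := by
  obtain ⟨x₀⟩ := cls_nonempty R
  obtain ⟨t, M, -, hM, hset⟩ := lambdaIn_eq_of_bounded (G := G) (N := fun _ => True) (x₀ := x₀)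
    hRT cR cS hq hH (fun _ _ _ => rfl) (fun _ _ _ _ h => (add_le_add_iff_left _).1 h)
    (fun t => (hG.lambdaMap_id hH t).imp fun _ h => ⟨trivial, h⟩) hbdd
  exact ⟨t, M, hM, by simpa using hset⟩

theorem IsShiftCoord.lambdaIn_id_of_unbounded (hG : IsShiftCoord φ R tr G)
    (hH : IsShiftCoord φ (R * T) id H) (cR : UnitCoord φ R I act)
    (cS : UnitCoord φ (R * T) J act') (q : ℝ → ℝ) (hq : ∀ s, (cS.iso s : ℝ) = q (H s))
    (hHtop : ∀ y, ∃ s, y ≤ H s) (hbdd : ¬ ∃ r s, ∀ t, F.lambdaMap R T t r ≤ s) :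
    LambdaIn cR cS = {k | ∃ c, ∀ r, k r = q (G (cR.iso.symm r) + c)} := by
  obtain ⟨x₀⟩ := cls_nonempty R
  simpa using lambdaIn_eq_of_unbounded (G := G) (N := fun _ => True) (x₀ := x₀)
    cR cS hq hH (fun _ _ _ => rfl) (fun _ _ _ _ h => (add_le_add_iff_left _).1 h)
    (fun t => (hG.lambdaMap_id hH t).imp fun _ h => ⟨trivial, h⟩) hHtop hbdd

end Shift

/-! ### Logarithmic shift coordinates for the four types -/

section Types

variable {φ : ProductIso F} {R : F.Quo}

theorem isShiftCoord_luk (c : LukCoord φ R) :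
    IsShiftCoord φ R (max · 0) fun x => (c.iso x : ℝ) / c.α where
  strictMono x y h := div_lt_div_of_pos_right (c.iso.strictMono h) c.α_pos
  map_rho f x := by
    have := c.α_pos.ne'
    rw [c.rho_eq, ← max_div_div_right c.α_pos.le, zero_div]
    congr 1
    field_simp

theorem isShiftCoord_prod (c : ProdCoord φ R) :
    IsShiftCoord φ R id fun x => Real.log (c.iso x) / c.α where
  strictMono x y h := div_lt_div_of_pos_right
    (Real.log_lt_log (c.iso x).2.1 (c.iso.strictMono h)) c.α_pos
  map_rho f x := by
    have := c.α_pos.ne'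
    rw [c.rho_eq, Real.log_mul (Real.rpow_pos_of_pos (φ f).2.1 _).ne' (c.iso x).2.1.ne',
      Real.log_rpow (φ f).2.1, id]
    field_simp
    ring

/-- The action divides `1 - r` by `f ^ α`, so `-log (1 - r)` is shifted by `α * log f`; truncation
at `r = 0` becomes truncation at 0. -/
theorem isShiftCoord_revProd (c : RevProdCoord φ R) :
    IsShiftCoord φ R (max · 0) fun x => -Real.log (1 - c.iso x) / c.α where
  strictMono x y h := by
    refine div_lt_div_of_pos_right (neg_lt_neg (Real.log_lt_log ?_ ?_)) c.α_pos
    · linarith [(c.iso y).2.2]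
    · have : (c.iso x : ℝ) < c.iso y := c.iso.strictMono h
      linarith
  map_rho f x := by
    have hα := c.α_pos.ne'
    have hf : 0 < (φ f : ℝ) ^ c.α := Real.rpow_pos_of_pos (φ f).2.1 _
    have hx : 0 < 1 - (c.iso x : ℝ) := by linarith [(c.iso x).2.2]
    have hlog : -Real.log ((1 - (c.iso x : ℝ)) / (φ f : ℝ) ^ c.α) / c.α =
        -Real.log (1 - c.iso x) / c.α + Real.log (φ f) := by
      rw [Real.log_div hx.ne' hf.ne', Real.log_rpow (φ f).2.1]
      field_simp
      ring
    rw [c.rho_eq, ← hlog]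
    rcases le_total ((1 - (c.iso x : ℝ)) / (φ f : ℝ) ^ c.α) 1 with h | h
    · rw [max_eq_left (by linarith), sub_sub_cancel, max_eq_left]
      exact div_nonneg (neg_nonneg.2 (Real.log_nonpos (by positivity) h)) c.α_pos.le
    · rw [max_eq_right (by linarith), sub_zero, Real.log_one, neg_zero, zero_div, max_eq_right]
      exact div_nonpos_of_nonpos_of_nonneg (neg_nonpos.2 (Real.log_nonneg h)) c.α_pos.le

/-- One logarithm turns the power into division of `-log r` by `f ^ α`, the second turns this into a
shift; the outer sign restores monotonicity. -/
theorem isShiftCoord_pow (c : PowCoord φ R) :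
    IsShiftCoord φ R id fun x => -Real.log (-Real.log (c.iso x)) / c.α where
  strictMono x y h := by
    refine div_lt_div_of_pos_right (neg_lt_neg (Real.log_lt_log ?_ (neg_lt_neg ?_))) c.α_pos
    · exact neg_pos.2 (Real.log_neg (c.iso y).2.1 (c.iso y).2.2)
    · exact Real.log_lt_log (c.iso x).2.1 (c.iso.strictMono h)
  map_rho f x := by
    have hα := c.α_pos.ne'
    have hf : 0 < (φ f : ℝ) ^ c.α := Real.rpow_pos_of_pos (φ f).2.1 _
    have hx := Real.log_neg (c.iso x).2.1 (c.iso x).2.2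
    rw [c.rho_eq, Real.log_rpow (c.iso x).2.1, ← mul_neg, Real.log_mul (by positivity) (by linarith),
      one_div, Real.log_inv, Real.log_rpow (φ f).2.1, id]
    field_simp
    ring

/-- This and its three analogues recover the unit coordinate from the shift coordinate; they supply
the function `q` in the descriptions of `LambdaIn`. -/
theorem luk_eq (c : LukCoord φ R) (x : F.cls R) :
    (c.iso x : ℝ) = c.α * ((c.iso x : ℝ) / c.α) := by
  have := c.α_pos.ne'
  field_simp

theorem prod_eq (c : ProdCoord φ R) (x : F.cls R) :
    (c.iso x : ℝ) = Real.exp (c.α * (Real.log (c.iso x) / c.α)) := by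
  rw [mul_div_cancel₀ _ c.α_pos.ne', Real.exp_log (c.iso x).2.1]

theorem revProd_eq (c : RevProdCoord φ R) (x : F.cls R) :
    (c.iso x : ℝ) = 1 - Real.exp (-(c.α * (-Real.log (1 - c.iso x) / c.α))) := by
  rw [mul_div_cancel₀ _ c.α_pos.ne', neg_neg, Real.exp_log (by linarith [(c.iso x).2.2])]
  ring

theorem pow_eq (c : PowCoord φ R) (x : F.cls R) :
    (c.iso x : ℝ) =
      Real.exp (-Real.exp (-(c.α * (-Real.log (-Real.log (c.iso x)) / c.α)))) := by
  rw [mul_div_cancel₀ _ c.α_pos.ne', neg_neg,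
    Real.exp_log (neg_pos.2 (Real.log_neg (c.iso x).2.1 (c.iso x).2.2)), neg_neg,
    Real.exp_log (c.iso x).2.1]

theorem revProd_unbounded (c : RevProdCoord φ R) (y : ℝ) :
    ∃ x, y < -Real.log (1 - c.iso x) / c.α := by
  refine ⟨c.iso.symm ⟨1 - Real.exp (-(c.α * (|y| + 1))), ?_, ?_⟩, ?_⟩
  · have := c.α_pos
    rw [sub_nonneg, Real.exp_le_one_iff, neg_nonpos]
    positivity
  · linarith [Real.exp_pos (-(c.α * (|y| + 1)))]
  · rw [c.iso.apply_symm_apply, sub_sub_cancel, Real.log_exp, neg_neg,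
      mul_div_cancel_left₀ _ c.α_pos.ne']
    linarith [le_abs_self y]

theorem pow_surjective (c : PowCoord φ R) (y : ℝ) :
    ∃ x, -Real.log (-Real.log (c.iso x)) / c.α = y := by
  refine ⟨c.iso.symm ⟨Real.exp (-Real.exp (-(c.α * y))), Real.exp_pos _, ?_⟩, ?_⟩
  · rw [Real.exp_lt_one_iff, neg_lt_zero]
    exact Real.exp_pos _
  · rw [c.iso.apply_symm_apply, Real.log_exp, neg_neg, Real.log_exp, neg_neg,
      mul_div_cancel_left₀ _ c.α_pos.ne']

end Types

end TomonoidFilter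

/-! ### The individual combinations of types -/

namespace TomonoidFilter

variable {L : Type*} [CommMonoid L] [LinearOrder L] [QNCTomonoid L] {F : TomonoidFilter L}
  {φ : ProductIso F} {R T : F.Quo}

theorem lambdaMap_luk_bounded (cS : LukCoord φ (R * T)) :
    ∃ r s, ∀ t, F.lambdaMap R T t r ≤ s := by
  obtain ⟨r⟩ := cls_nonempty R
  exact ⟨r, cS.iso.symm 1, fun t => cS.iso.le_symm_apply.2 (cS.iso _).2.2⟩

theorem lambdaMap_prod_bounded (cS : ProdCoord φ (R * T)) :
    ∃ r s, ∀ t, F.lambdaMap R T t r ≤ s := by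
  obtain ⟨r⟩ := cls_nonempty R
  exact ⟨r, cS.iso.symm ⟨1, one_pos, le_rfl⟩, fun t => cS.iso.le_symm_apply.2 (cS.iso _).2.2⟩

theorem le_symm_one (cR : LukCoord φ R) (x : F.cls R) : x ≤ cR.iso.symm 1 :=
  cR.iso.le_symm_apply.2 (cR.iso x).2.2

theorem le_symm_one_prod (cR : ProdCoord φ R) (x : F.cls R) :
    x ≤ cR.iso.symm ⟨1, one_pos, le_rfl⟩ :=
  cR.iso.le_symm_apply.2 (cR.iso x).2.2

theorem luk_symm_one (cR : LukCoord φ R) :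
    (cR.iso (cR.iso.symm 1) : ℝ) / cR.α = 1 / cR.α := by
  rw [cR.iso.apply_symm_apply]
  simp

theorem prod_symm_one (cR : ProdCoord φ R) :
    Real.log (cR.iso (cR.iso.symm ⟨1, one_pos, le_rfl⟩)) / cR.α = 0 := by
  rw [cR.iso.apply_symm_apply]
  simp

theorem luk_symm_zero (cR : LukCoord φ R) :
    (cR.iso (cR.iso.symm 0) : ℝ) / cR.α = 0 := by
  rw [cR.iso.apply_symm_apply]
  simp

theorem revProd_symm_zero (cR : RevProdCoord φ R) :
    -Real.log (1 - cR.iso (cR.iso.symm ⟨0, le_rfl, one_pos⟩)) / cR.α = 0 := by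
  rw [cR.iso.apply_symm_apply]
  simp

theorem one_sub_exp_neg_max {β : ℝ} (hβ : 0 < β) (y : ℝ) :
    1 - Real.exp (-(β * max y 0)) = max (1 - Real.exp (-(β * y))) 0 := by
  rcases le_total y 0 with h | h
  · rw [max_eq_right h, max_eq_right]
    · simp
    · rw [sub_nonpos, Real.one_le_exp_iff, neg_nonneg]
      exact mul_nonpos_of_nonneg_of_nonpos hβ.le h
  · rw [max_eq_left h, max_eq_left]
    rw [sub_nonneg, Real.exp_le_one_iff, neg_nonpos]
    positivity

theorem lambdaIn_luk_luk (hRT : IsOdotMaximal R T) (cR : LukCoord φ R) (cS : LukCoord φ (R * T)) :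
    ∃ m ∈ Set.Icc (-(cS.α / cR.α)) (min (1 - cS.α / cR.α) 0),
      LambdaIn cR cS = {h : Set.Icc (0 : ℝ) 1 → ℝ | ∃ z : ℝ, -(cS.α / cR.α) ≤ z ∧ z ≤ m ∧
        ∀ r, h r = max (cS.α / cR.α * (r : ℝ) + z) 0} := by
  have hG := isShiftCoord_luk cR
  have hH := isShiftCoord_luk cS
  have hα := cR.α_pos
  have hβ := cS.α_pos
  obtain ⟨t, M, hNM, hM, hset⟩ := hG.lambdaIn_max_of_bounded hH hRT cR cS
    (fun y => cS.α * y) (luk_eq cS) (le_symm_one cR) (lambdaMap_luk_bounded cS)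
  rw [luk_symm_one] at hNM
  -- The two upper bounds on `m` come from the ends of `R`: bottom goes to bottom, and the image of
  -- the top is at most 1.
  have hM0 : M ≤ 0 := by
    have h1 := hM (cR.iso.symm 0)
    rw [hG.lambdaMap_of_eq_zero hH t (luk_symm_zero cR), luk_symm_zero, zero_add] at h1
    exact max_eq_right_iff.1 h1.symm
  have hM1 : 1 / cR.α + M ≤ 1 / cS.α := by
    have h1 := hM (cR.iso.symm 1)
    rw [luk_symm_one] at h1
    refine (le_max_left _ 0).trans (h1.symm.trans_le ?_)
    exact div_le_div_of_nonneg_right (cS.iso _).2.2 hβ.le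
  have hκ : -(cS.α / cR.α) = cS.α * -(1 / cR.α) := by ring
  refine ⟨cS.α * M, ⟨?_, le_min ?_ (mul_nonpos_of_nonneg_of_nonpos hβ.le hM0)⟩, ?_⟩
  · rw [hκ]
    exact mul_le_mul_of_nonneg_left hNM hβ.le
  · have := mul_le_mul_of_nonneg_left hM1 hβ.le
    rw [mul_one_div_cancel hβ.ne'] at this
    linarith
  · have hval : ∀ r c : ℝ, cS.α * max (r / cR.α + c) 0 =
        max (cS.α / cR.α * r + cS.α * c) 0 := fun r c => by
      rw [mul_max_of_nonneg _ _ hβ.le, mul_zero]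
      congr 1
      ring
    rw [hset]
    ext k
    simp only [OrderIso.apply_symm_apply, hval, hκ, Set.mem_ofPred_eq, Set.Icc.coe_one]
    constructor
    · rintro ⟨c, hc, hcM, hk⟩
      exact ⟨cS.α * c, mul_le_mul_of_nonneg_left hc hβ.le,
        mul_le_mul_of_nonneg_left hcM hβ.le, hk⟩
    · rintro ⟨z, hz, hzM, hk⟩
      have hz' : cS.α * (z / cS.α) = z := mul_div_cancel₀ _ hβ.ne'
      refine ⟨z / cS.α, ?_, ?_, by simpa only [hz'] using hk⟩
      · rwa [← hz', mul_le_mul_iff_right₀ hβ] at hz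
      · rwa [← hz', mul_le_mul_iff_right₀ hβ] at hzM

theorem lambdaIn_luk_revProd (hRT : IsOdotMaximal R T) (cR : LukCoord φ R)
    (cS : RevProdCoord φ (R * T)) :
    ∃ m ∈ Set.Icc (-1 : ℝ) 0,
      LambdaIn cR cS = {h : Set.Icc (0 : ℝ) 1 → ℝ | ∃ z : ℝ, -1 ≤ z ∧ z ≤ m ∧
        ∀ r, h r = max (1 - Real.exp (-(cS.α / cR.α) * ((r : ℝ) + z))) 0} := by
  have hG := isShiftCoord_luk cR
  have hH := isShiftCoord_revProd cS
  have hα := cR.α_pos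
  have hβ := cS.α_pos
  have hzero := fun t : F.cls T => hG.lambdaMap_of_eq_zero hH t (luk_symm_zero cR)
  -- `S` has no top, but every map sends the bottom of `R` to the bottom of `S`, so the products
  -- with that one element are bounded.
  have hbdd : ∃ r s, ∀ t, F.lambdaMap R T t r ≤ s := by
    obtain ⟨t₀⟩ := cls_nonempty T
    refine ⟨cR.iso.symm 0, F.lambdaMap R T t₀ (cR.iso.symm 0), fun t => ?_⟩
    exact hH.strictMono.le_iff_le.1 (by rw [hzero, hzero])
  obtain ⟨t, M, hNM, hM, hset⟩ := hG.lambdaIn_max_of_bounded hH hRT cR cS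
      (fun y => 1 - Real.exp (-(cS.α * y))) (revProd_eq cS) (le_symm_one cR) hbdd
  rw [luk_symm_one] at hNM
  have hM0 : M ≤ 0 := by
    have h1 := hM (cR.iso.symm 0)
    rw [hzero, luk_symm_zero, zero_add] at h1
    exact max_eq_right_iff.1 h1.symm
  have hscale : ∀ c, -(1 / cR.α) ≤ c ↔ -1 ≤ cR.α * c := fun c => by
    rw [← neg_div, div_le_iff₀' hα]
  -- The parameter `z` stands inside the exponential next to `r`, so `c` is rescaled by the
  -- coefficient of `R`, not of `S`.
  refine ⟨cR.α * M, ⟨(hscale M).1 hNM, mul_nonpos_of_nonneg_of_nonpos hα.le hM0⟩, ?_⟩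
  have hval : ∀ r c : ℝ, 1 - Real.exp (-(cS.α * max (r / cR.α + c) 0)) =
      max (1 - Real.exp (-(cS.α / cR.α) * (r + cR.α * c))) 0 := fun r c => by
    rw [one_sub_exp_neg_max hβ]
    congr 3
    field_simp
  rw [hset]
  ext k
  simp only [OrderIso.apply_symm_apply, hval, hscale, Set.mem_ofPred_eq, Set.Icc.coe_one]
  constructor
  · rintro ⟨c, hc, hcM, hk⟩
    exact ⟨cR.α * c, hc, mul_le_mul_of_nonneg_left hcM hα.le, hk⟩
  · rintro ⟨z, hz, hzM, hk⟩
    have hz' : cR.α * (z / cR.α) = z := mul_div_cancel₀ _ hα.ne'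
    refine ⟨z / cR.α, by rwa [hz'], ?_, by simpa only [hz'] using hk⟩
    rwa [← hz', mul_le_mul_iff_right₀ hα] at hzM

theorem lambdaIn_prod_luk (hRT : IsOdotMaximal R T) (cR : ProdCoord φ R)
    (cS : LukCoord φ (R * T)) :
    ∃ m ∈ Set.Icc (0 : ℝ) 1,
      LambdaIn cR cS = {h : Set.Ioc (0 : ℝ) 1 → ℝ | ∃ z : ℝ, 0 ≤ z ∧ z ≤ m ∧
        ∀ r, h r = max (cS.α / cR.α * Real.log (r : ℝ) + z) 0} := by
  have hG := isShiftCoord_prod cR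
  have hH := isShiftCoord_luk cS
  have hβ := cS.α_pos
  obtain ⟨t, M, hNM, hM, hset⟩ := hG.lambdaIn_max_of_bounded hH hRT cR cS
    (fun y => cS.α * y) (luk_eq cS) (le_symm_one_prod cR) (lambdaMap_luk_bounded cS)
  simp only [prod_symm_one, neg_zero] at hNM hset
  have hM1 : cS.α * M ≤ 1 := by
    have h1 := hM (cR.iso.symm ⟨1, one_pos, le_rfl⟩)
    rw [prod_symm_one, zero_add, max_eq_left hNM] at h1
    rw [← h1, mul_div_cancel₀ _ hβ.ne']
    exact (cS.iso _).2.2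
  refine ⟨cS.α * M, ⟨mul_nonneg hβ.le hNM, hM1⟩, ?_⟩
  have hval : ∀ r c : ℝ, cS.α * max (Real.log r / cR.α + c) 0 =
      max (cS.α / cR.α * Real.log r + cS.α * c) 0 := fun r c => by
    rw [mul_max_of_nonneg _ _ hβ.le, mul_zero]
    congr 1
    ring
  rw [hset]
  ext k
  simp only [OrderIso.apply_symm_apply, hval, Set.mem_ofPred_eq]
  constructor
  · rintro ⟨c, hc, hcM, hk⟩
    exact ⟨cS.α * c, mul_nonneg hβ.le hc, mul_le_mul_of_nonneg_left hcM hβ.le, hk⟩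
  · rintro ⟨z, hz, hzM, hk⟩
    have hz' : cS.α * (z / cS.α) = z := mul_div_cancel₀ _ hβ.ne'
    refine ⟨z / cS.α, div_nonneg hz hβ.le, ?_, by simpa only [hz'] using hk⟩
    rwa [← hz', mul_le_mul_iff_right₀ hβ] at hzM

theorem exp_mul_log_div_add {α β r : ℝ} (hr : 0 < r) (c : ℝ) :
    Real.exp (β * (Real.log r / α + c)) = Real.exp (β * c) * r ^ (β / α) := by
  rw [Real.rpow_def_of_pos hr, ← Real.exp_add]
  congr 1
  ring

theorem lambdaIn_prod_prod (hRT : IsOdotMaximal R T) (cR : ProdCoord φ R)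
    (cS : ProdCoord φ (R * T)) :
    ∃ m ∈ Set.Ioc (0 : ℝ) 1,
      LambdaIn cR cS = {h : Set.Ioc (0 : ℝ) 1 → ℝ | ∃ z : ℝ, 0 < z ∧ z ≤ m ∧
        ∀ r, h r = z * (r : ℝ) ^ (cS.α / cR.α)} := by
  have hG := isShiftCoord_prod cR
  have hH := isShiftCoord_prod cS
  have hβ := cS.α_pos
  obtain ⟨t, M, hM, hset⟩ := hG.lambdaIn_id_of_bounded hH hRT cR cS
    (fun y => Real.exp (cS.α * y)) (prod_eq cS) (lambdaMap_prod_bounded cS)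
  have hM0 : M ≤ 0 := by
    have h1 := hM (cR.iso.symm ⟨1, one_pos, le_rfl⟩)
    rw [prod_symm_one, zero_add] at h1
    rw [← h1]
    exact div_nonpos_of_nonpos_of_nonneg (Real.log_nonpos (cS.iso _).2.1.le (cS.iso _).2.2) hβ.le
  refine ⟨Real.exp (cS.α * M), ⟨Real.exp_pos _, Real.exp_le_one_iff.2
    (mul_nonpos_of_nonneg_of_nonpos hβ.le hM0)⟩, ?_⟩
  have hval : ∀ (r : Set.Ioc (0 : ℝ) 1) (c : ℝ), Real.exp (cS.α * (Real.log r / cR.α + c)) =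
      Real.exp (cS.α * c) * (r : ℝ) ^ (cS.α / cR.α) := fun r c => exp_mul_log_div_add r.2.1 c
  rw [hset]
  ext k
  simp only [OrderIso.apply_symm_apply, hval, Set.mem_ofPred_eq]
  constructor
  · rintro ⟨c, hcM, hk⟩
    exact ⟨_, Real.exp_pos _, Real.exp_le_exp.2 (mul_le_mul_of_nonneg_left hcM hβ.le), hk⟩
  · rintro ⟨z, hz, hzM, hk⟩
    have hz' : Real.exp (cS.α * (Real.log z / cS.α)) = z := by
      rw [mul_div_cancel₀ _ hβ.ne', Real.exp_log hz]
    refine ⟨Real.log z / cS.α, ?_, by simpa only [hz'] using hk⟩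
    rwa [← hz', Real.exp_le_exp, mul_le_mul_iff_right₀ hβ] at hzM

theorem lambdaIn_prod_revProd (hRT : IsOdotMaximal R T) (cR : ProdCoord φ R)
    (cS : RevProdCoord φ (R * T)) :
    LambdaIn cR cS = {h : Set.Ioc (0 : ℝ) 1 → ℝ | ∃ z : ℝ, 1 ≤ z ∧
        ∀ r, h r = max (1 - 1 / (z * (r : ℝ) ^ (cS.α / cR.α))) 0} ∨
    ∃ m : ℝ, 1 ≤ m ∧
      LambdaIn cR cS = {h : Set.Ioc (0 : ℝ) 1 → ℝ | ∃ z : ℝ, 1 ≤ z ∧ z ≤ m ∧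
        ∀ r, h r = max (1 - 1 / (z * (r : ℝ) ^ (cS.α / cR.α))) 0} := by
  have hG := isShiftCoord_prod cR
  have hH := isShiftCoord_revProd cS
  have hβ := cS.α_pos
  have hval : ∀ (r : Set.Ioc (0 : ℝ) 1) (c : ℝ),
      1 - Real.exp (-(cS.α * max (Real.log r / cR.α + c) 0)) =
      max (1 - 1 / (Real.exp (cS.α * c) * (r : ℝ) ^ (cS.α / cR.α))) 0 := fun r c => by
    rw [one_sub_exp_neg_max hβ, ← exp_mul_log_div_add r.2.1 c, Real.exp_neg, one_div]
  have hpos : ∀ {c : ℝ}, 0 ≤ c → 1 ≤ Real.exp (cS.α * c) := fun hc =>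
    Real.one_le_exp_iff.2 (mul_nonneg hβ.le hc)
  have hz' : ∀ {z : ℝ}, 1 ≤ z → Real.exp (cS.α * (Real.log z / cS.α)) = z := fun hz => by
    rw [mul_div_cancel₀ _ hβ.ne', Real.exp_log (by linarith)]
  -- `S` has no top and `R` has no bottom, so neither end forces a bound; the two alternatives
  -- correspond to this dichotomy.
  by_cases hbdd : ∃ r s, ∀ t, F.lambdaMap R T t r ≤ s
  · right
    obtain ⟨t, M, hNM, -, hset⟩ := hG.lambdaIn_max_of_bounded hH hRT cR cS
      (fun y => 1 - Real.exp (-(cS.α * y))) (revProd_eq cS) (le_symm_one_prod cR) hbdd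
    simp only [prod_symm_one, neg_zero] at hNM hset
    refine ⟨Real.exp (cS.α * M), hpos hNM, ?_⟩
    rw [hset]
    ext k
    simp only [OrderIso.apply_symm_apply, hval, Set.mem_ofPred_eq]
    constructor
    · rintro ⟨c, hc, hcM, hk⟩
      exact ⟨_, hpos hc, Real.exp_le_exp.2 (mul_le_mul_of_nonneg_left hcM hβ.le), hk⟩
    · rintro ⟨z, hz, hzM, hk⟩
      refine ⟨Real.log z / cS.α, div_nonneg (Real.log_nonneg hz) hβ.le, ?_,
        by simpa only [hz' hz] using hk⟩
      rwa [← hz' hz, Real.exp_le_exp, mul_le_mul_iff_right₀ hβ] at hzM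
  · left
    have hset := hG.lambdaIn_max_of_unbounded hH cR cS
      (fun y => 1 - Real.exp (-(cS.α * y))) (revProd_eq cS) (le_symm_one_prod cR)
      (fun y => (revProd_unbounded cS y).imp fun _ => le_of_lt) hbdd
    simp only [prod_symm_one, neg_zero] at hset
    rw [hset]
    ext k
    simp only [OrderIso.apply_symm_apply, hval, Set.mem_ofPred_eq]
    constructor
    · rintro ⟨c, hc, hk⟩
      exact ⟨_, hpos hc, hk⟩
    · rintro ⟨z, hz, hk⟩
      exact ⟨Real.log z / cS.α, div_nonneg (Real.log_nonneg hz) hβ.le,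
        by simpa only [hz' hz] using hk⟩

/-- The maps into a class with power action, whatever the action on the source. -/
theorem lambdaIn_pow {I : Set ℝ} {act : ℝ → ℝ → ℝ → ℝ} {tr : ℝ → ℝ} {G : F.cls R → ℝ}
    (hRT : IsOdotMaximal R T) (cR : UnitCoord φ R I act) (hG : IsShiftCoord φ R tr G)
    (cS : PowCoord φ (R * T)) {e : I → ℝ}
    (he : ∀ r, e r = Real.exp (-(cS.α * G (cR.iso.symm r)))) :
    LambdaIn cR cS = {h | ∃ z : ℝ, 0 < z ∧ z < 1 ∧ ∀ r, h r = z ^ e r} ∨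
    ∃ m ∈ Set.Ioo (0 : ℝ) 1, LambdaIn cR cS = {h | ∃ z : ℝ, 0 < z ∧ z ≤ m ∧ ∀ r, h r = z ^ e r} := by
  have hH := isShiftCoord_pow cS
  have hβ := cS.α_pos
  have hval : ∀ r c, Real.exp (-Real.exp (-(cS.α * (G (cR.iso.symm r) + c)))) =
      Real.exp (-Real.exp (-(cS.α * c))) ^ e r := fun r c => by
    rw [he, ← Real.exp_mul, neg_mul, ← Real.exp_add]
    congr 3
    ring
  have hlt : ∀ c, Real.exp (-Real.exp (-(cS.α * c))) < 1 := fun c => by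
    rw [Real.exp_lt_one_iff, neg_lt_zero]
    exact Real.exp_pos _
  have hle : ∀ c c', Real.exp (-Real.exp (-(cS.α * c))) ≤ Real.exp (-Real.exp (-(cS.α * c'))) ↔
      c ≤ c' := fun c c' => by
    rw [Real.exp_le_exp, neg_le_neg_iff, Real.exp_le_exp, neg_le_neg_iff, mul_le_mul_iff_right₀ hβ]
  have hz' : ∀ {z : ℝ}, 0 < z → z < 1 →
      Real.exp (-Real.exp (-(cS.α * (-Real.log (-Real.log z) / cS.α)))) = z := fun h0 h1 => by
    rw [mul_div_cancel₀ _ hβ.ne', neg_neg, Real.exp_log (neg_pos.2 (Real.log_neg h0 h1)), neg_neg,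
      Real.exp_log h0]
  by_cases hbdd : ∃ r s, ∀ t, F.lambdaMap R T t r ≤ s
  · right
    obtain ⟨t, M, -, hset⟩ := hG.lambdaIn_id_of_bounded hH hRT cR cS
      (fun y => Real.exp (-Real.exp (-(cS.α * y)))) (pow_eq cS) hbdd
    refine ⟨_, ⟨Real.exp_pos _, hlt M⟩, ?_⟩
    rw [hset]
    ext k
    simp only [hval, Set.mem_ofPred_eq]
    constructor
    · rintro ⟨c, hcM, hk⟩
      exact ⟨_, Real.exp_pos _, (hle c M).2 hcM, hk⟩
    · rintro ⟨z, hz, hzM, hk⟩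
      have hz1 := hzM.trans_lt (hlt M)
      refine ⟨-Real.log (-Real.log z) / cS.α, ?_, by simpa only [hz' hz hz1] using hk⟩
      rwa [← hz' hz hz1, hle] at hzM
  · left
    rw [hG.lambdaIn_id_of_unbounded hH cR cS (fun y => Real.exp (-Real.exp (-(cS.α * y)))) (pow_eq cS)
      (fun y => (pow_surjective cS y).imp fun _ => ge_of_eq) hbdd]
    ext k
    simp only [hval, Set.mem_ofPred_eq]
    constructor
    · rintro ⟨c, hk⟩
      exact ⟨_, Real.exp_pos _, hlt c, hk⟩
    · rintro ⟨z, hz, hz1, hk⟩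
      exact ⟨-Real.log (-Real.log z) / cS.α, by simpa only [hz' hz hz1] using hk⟩

theorem lambdaIn_prod_pow (hRT : IsOdotMaximal R T) (cR : ProdCoord φ R)
    (cS : PowCoord φ (R * T)) :
    LambdaIn cR cS = {h : Set.Ioc (0 : ℝ) 1 → ℝ | ∃ z : ℝ, 0 < z ∧ z < 1 ∧
        ∀ r, h r = z ^ ((r : ℝ) ^ (-(cS.α / cR.α)))} ∨
    ∃ m ∈ Set.Ioo (0 : ℝ) 1,
      LambdaIn cR cS = {h : Set.Ioc (0 : ℝ) 1 → ℝ | ∃ z : ℝ, 0 < z ∧ z ≤ m ∧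
        ∀ r, h r = z ^ ((r : ℝ) ^ (-(cS.α / cR.α)))} :=
  lambdaIn_pow hRT cR (isShiftCoord_prod cR) cS fun r => by
    rw [cR.iso.apply_symm_apply, Real.rpow_def_of_pos r.2.1]
    congr 1
    ring

theorem lambdaIn_pow_pow (hRT : IsOdotMaximal R T) (cR : PowCoord φ R)
    (cS : PowCoord φ (R * T)) :
    LambdaIn cR cS = {h : Set.Ioo (0 : ℝ) 1 → ℝ | ∃ z : ℝ, 0 < z ∧ z < 1 ∧
        ∀ r, h r = z ^ ((-Real.log (r : ℝ)) ^ (cS.α / cR.α))} ∨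
    ∃ m ∈ Set.Ioo (0 : ℝ) 1,
      LambdaIn cR cS = {h : Set.Ioo (0 : ℝ) 1 → ℝ | ∃ z : ℝ, 0 < z ∧ z ≤ m ∧
        ∀ r, h r = z ^ ((-Real.log (r : ℝ)) ^ (cS.α / cR.α))} :=
  lambdaIn_pow hRT cR (isShiftCoord_pow cR) cS fun r => by
    rw [cR.iso.apply_symm_apply, Real.rpow_def_of_pos (neg_pos.2 (Real.log_neg r.2.1 r.2.2))]
    congr 1
    ring

theorem one_sub_exp_neg_max_log {α β r : ℝ} (hβ : 0 < β) (hr : 0 < r) (c : ℝ) :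
    1 - Real.exp (-(β * max (-Real.log r / α + c) 0)) =
      max (1 - r ^ (β / α) / Real.exp (β * c)) 0 := by
  rw [one_sub_exp_neg_max hβ, Real.rpow_def_of_pos hr, ← Real.exp_sub]
  congr 3
  ring

theorem lambdaIn_revProd_revProd (cR : RevProdCoord φ R) (cS : RevProdCoord φ (R * T)) :
    F.IsTrivialPair R T ∨
    ∃ m ∈ Set.Ioc (0 : ℝ) 1,
      LambdaIn cR cS ⊆ {h : Set.Ico (0 : ℝ) 1 → ℝ | ∃ z : ℝ, 0 < z ∧ z ≤ m ∧
        ∀ r, h r = max (1 - (1 - (r : ℝ)) ^ (cS.α / cR.α) / z) 0} := by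
  have hG := isShiftCoord_revProd cR
  have hH := isShiftCoord_revProd cS
  refine (hG.isTrivialPair_or hH (revProd_unbounded cR) (revProd_symm_zero cS)).imp_right
    -- For an inclusion `m = 1` suffices: bottom goes to bottom, so `c ≤ 0` and `exp (cS.α * c) ≤
    -- 1`.
    fun hform => ⟨1, ⟨one_pos, le_rfl⟩, fun k hk => ?_⟩
  obtain ⟨t, ht⟩ := (mem_lambdaIn_iff cR cS (revProd_eq cS)).1 hk
  obtain ⟨c, hc⟩ := hform t
  have hc0 : c ≤ 0 := by
    have h1 := hc (cR.iso.symm ⟨0, le_rfl, one_pos⟩)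
    rw [hG.lambdaMap_of_eq_zero hH t (revProd_symm_zero cR), revProd_symm_zero, zero_add] at h1
    exact max_eq_right_iff.1 h1.symm
  refine ⟨Real.exp (cS.α * c), Real.exp_pos _, Real.exp_le_one_iff.2
    (mul_nonpos_of_nonneg_of_nonpos cS.α_pos.le hc0), fun r => ?_⟩
  rw [ht, hc, cR.iso.apply_symm_apply, one_sub_exp_neg_max_log cS.α_pos (by linarith [r.2.2])]

theorem lambdaIn_pow_revProd (cR : PowCoord φ R) (cS : RevProdCoord φ (R * T)) :
    F.IsTrivialPair R T ∨
    LambdaIn cR cS ⊆ {h : Set.Ioo (0 : ℝ) 1 → ℝ | ∃ z : ℝ, 0 < z ∧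
      ∀ r, h r = max (1 - (-Real.log (r : ℝ)) ^ (cS.α / cR.α) / z) 0} := by
  refine ((isShiftCoord_pow cR).isTrivialPair_or (isShiftCoord_revProd cS) (fun y => ?_)
    (revProd_symm_zero cS)).imp_right fun hform k hk => ?_
  · obtain ⟨x, hx⟩ := pow_surjective cR (y + 1)
    exact ⟨x, by linarith⟩
  · obtain ⟨t, ht⟩ := (mem_lambdaIn_iff cR cS (revProd_eq cS)).1 hk
    obtain ⟨c, hc⟩ := hform t
    refine ⟨Real.exp (cS.α * c), Real.exp_pos _, fun r => ?_⟩
    rw [ht, hc, cR.iso.apply_symm_apply,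
      one_sub_exp_neg_max_log cS.α_pos (neg_pos.2 (Real.log_neg r.2.1 r.2.2))]

end TomonoidFilter

theorem mainTheorem1 {L : Type*} [CommMonoid L] [LinearOrder L] [QNCTomonoid L]
    (F : TomonoidFilter L)
    (hArch : IsArchimedeanTomonoid F.toSubmonoid)
    (hReal : ∀ Q : F.Quo, ∃ I : Set ℝ, IsRealInterval I ∧ Nonempty (F.cls Q ≃o I))
    (hMin : ¬ ∃ d, IsLeast (F.toSubmonoid : Set L) d)
    (R T : F.Quo) (hT : T < 1) (hRT : IsOdotMaximal R T) :
    -- `F` is a product tomonoid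
    Nonempty (ProductIso F) ∧ ∀ φ : ProductIso F,
    -- (i)
    (IsLukasiewicz (F.LambdaCls R) → IsLukasiewicz (F.LambdaCls (R * T)) →
      Nonempty (LukCoord φ R) ∧ Nonempty (LukCoord φ (R * T)) ∧
      ∀ (cR : LukCoord φ R) (cS : LukCoord φ (R * T)),
        ∃ m ∈ Set.Icc (-(cS.α / cR.α)) (min (1 - cS.α / cR.α) 0),
          LambdaIn cR cS = {h : Set.Icc (0 : ℝ) 1 → ℝ | ∃ z : ℝ, -(cS.α / cR.α) ≤ z ∧ z ≤ m ∧
            ∀ r, h r = max (cS.α / cR.α * (r : ℝ) + z) 0}) ∧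
    -- (ii)
    (IsLukasiewicz (F.LambdaCls R) → IsRevProduct (F.LambdaCls (R * T)) →
      Nonempty (LukCoord φ R) ∧ Nonempty (RevProdCoord φ (R * T)) ∧
      ∀ (cR : LukCoord φ R) (cS : RevProdCoord φ (R * T)),
        ∃ m ∈ Set.Icc (-1 : ℝ) 0,
          LambdaIn cR cS = {h : Set.Icc (0 : ℝ) 1 → ℝ | ∃ z : ℝ, -1 ≤ z ∧ z ≤ m ∧
            ∀ r, h r = max (1 - Real.exp (-(cS.α / cR.α) * ((r : ℝ) + z))) 0}) ∧
    -- (iii)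
    (IsProduct (F.LambdaCls R) → IsLukasiewicz (F.LambdaCls (R * T)) →
      Nonempty (ProdCoord φ R) ∧ Nonempty (LukCoord φ (R * T)) ∧
      ∀ (cR : ProdCoord φ R) (cS : LukCoord φ (R * T)),
        ∃ m ∈ Set.Icc (0 : ℝ) 1,
          LambdaIn cR cS = {h : Set.Ioc (0 : ℝ) 1 → ℝ | ∃ z : ℝ, 0 ≤ z ∧ z ≤ m ∧
            ∀ r, h r = max (cS.α / cR.α * Real.log (r : ℝ) + z) 0}) ∧
    -- (iv)
    (IsProduct (F.LambdaCls R) → IsProduct (F.LambdaCls (R * T)) →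
      Nonempty (ProdCoord φ R) ∧ Nonempty (ProdCoord φ (R * T)) ∧
      ∀ (cR : ProdCoord φ R) (cS : ProdCoord φ (R * T)),
        ∃ m ∈ Set.Ioc (0 : ℝ) 1,
          LambdaIn cR cS = {h : Set.Ioc (0 : ℝ) 1 → ℝ | ∃ z : ℝ, 0 < z ∧ z ≤ m ∧
            ∀ r, h r = z * (r : ℝ) ^ (cS.α / cR.α)}) ∧
    -- (v)
    (IsProduct (F.LambdaCls R) → IsRevProduct (F.LambdaCls (R * T)) →
      Nonempty (ProdCoord φ R) ∧ Nonempty (RevProdCoord φ (R * T)) ∧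
      ∀ (cR : ProdCoord φ R) (cS : RevProdCoord φ (R * T)),
        LambdaIn cR cS = {h : Set.Ioc (0 : ℝ) 1 → ℝ | ∃ z : ℝ, 1 ≤ z ∧
            ∀ r, h r = max (1 - 1 / (z * (r : ℝ) ^ (cS.α / cR.α))) 0} ∨
        ∃ m : ℝ, 1 ≤ m ∧
          LambdaIn cR cS = {h : Set.Ioc (0 : ℝ) 1 → ℝ | ∃ z : ℝ, 1 ≤ z ∧ z ≤ m ∧
            ∀ r, h r = max (1 - 1 / (z * (r : ℝ) ^ (cS.α / cR.α))) 0}) ∧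
    -- (vi)
    (IsProduct (F.LambdaCls R) → IsPower (F.LambdaCls (R * T)) →
      Nonempty (ProdCoord φ R) ∧ Nonempty (PowCoord φ (R * T)) ∧
      ∀ (cR : ProdCoord φ R) (cS : PowCoord φ (R * T)),
        LambdaIn cR cS = {h : Set.Ioc (0 : ℝ) 1 → ℝ | ∃ z : ℝ, 0 < z ∧ z < 1 ∧
            ∀ r, h r = z ^ ((r : ℝ) ^ (-(cS.α / cR.α)))} ∨
        ∃ m ∈ Set.Ioo (0 : ℝ) 1,
          LambdaIn cR cS = {h : Set.Ioc (0 : ℝ) 1 → ℝ | ∃ z : ℝ, 0 < z ∧ z ≤ m ∧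
            ∀ r, h r = z ^ ((r : ℝ) ^ (-(cS.α / cR.α)))}) ∧
    -- (vii)
    (IsRevProduct (F.LambdaCls R) → IsRevProduct (F.LambdaCls (R * T)) →
      Nonempty (RevProdCoord φ R) ∧ Nonempty (RevProdCoord φ (R * T)) ∧
      ∀ (cR : RevProdCoord φ R) (cS : RevProdCoord φ (R * T)),
        F.IsTrivialPair R T ∨
        ∃ m ∈ Set.Ioc (0 : ℝ) 1,
          LambdaIn cR cS ⊆ {h : Set.Ico (0 : ℝ) 1 → ℝ | ∃ z : ℝ, 0 < z ∧ z ≤ m ∧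
            ∀ r, h r = max (1 - (1 - (r : ℝ)) ^ (cS.α / cR.α) / z) 0}) ∧
    -- (viii)
    (IsPower (F.LambdaCls R) → IsRevProduct (F.LambdaCls (R * T)) →
      Nonempty (PowCoord φ R) ∧ Nonempty (RevProdCoord φ (R * T)) ∧
      ∀ (cR : PowCoord φ R) (cS : RevProdCoord φ (R * T)),
        F.IsTrivialPair R T ∨
        LambdaIn cR cS ⊆ {h : Set.Ioo (0 : ℝ) 1 → ℝ | ∃ z : ℝ, 0 < z ∧
            ∀ r, h r = max (1 - (-Real.log (r : ℝ)) ^ (cS.α / cR.α) / z) 0} ∨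
        ∃ m : ℝ, 0 < m ∧
          LambdaIn cR cS ⊆ {h : Set.Ioo (0 : ℝ) 1 → ℝ | ∃ z : ℝ, 0 < z ∧ z ≤ m ∧
            ∀ r, h r = max (1 - (-Real.log (r : ℝ)) ^ (cS.α / cR.α) / z) 0}) ∧
    -- (ix)
    (IsPower (F.LambdaCls R) → IsPower (F.LambdaCls (R * T)) →
      Nonempty (PowCoord φ R) ∧ Nonempty (PowCoord φ (R * T)) ∧
      ∀ (cR : PowCoord φ R) (cS : PowCoord φ (R * T)),
        LambdaIn cR cS = {h : Set.Ioo (0 : ℝ) 1 → ℝ | ∃ z : ℝ, 0 < z ∧ z < 1 ∧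
            ∀ r, h r = z ^ ((-Real.log (r : ℝ)) ^ (cS.α / cR.α))} ∨
        ∃ m ∈ Set.Ioo (0 : ℝ) 1,
          LambdaIn cR cS = {h : Set.Ioo (0 : ℝ) 1 → ℝ | ∃ z : ℝ, 0 < z ∧ z ≤ m ∧
            ∀ r, h r = z ^ ((-Real.log (r : ℝ)) ^ (cS.α / cR.α))}) := by
  -- The class of 1 is `F` itself; its interval model supplies the density needed for Hölder's
  -- theorem.
  obtain ⟨I, hI, ⟨e⟩⟩ := hReal 1
  refine ⟨F.nonempty_productIso hArch hI e hMin, fun φ => ⟨?_, ?_, ?_, ?_, ?_, ?_, ?_, ?_, ?_⟩⟩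
  · exact fun h h' => ⟨TomonoidFilter.nonempty_lukCoord φ h, TomonoidFilter.nonempty_lukCoord φ h',
      TomonoidFilter.lambdaIn_luk_luk hRT⟩
  · exact fun h h' => ⟨TomonoidFilter.nonempty_lukCoord φ h,
      TomonoidFilter.nonempty_revProdCoord φ h', TomonoidFilter.lambdaIn_luk_revProd hRT⟩
  · exact fun h h' => ⟨TomonoidFilter.nonempty_prodCoord φ h,
      TomonoidFilter.nonempty_lukCoord φ h', TomonoidFilter.lambdaIn_prod_luk hRT⟩
  · exact fun h h' => ⟨TomonoidFilter.nonempty_prodCoord φ h,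
      TomonoidFilter.nonempty_prodCoord φ h', TomonoidFilter.lambdaIn_prod_prod hRT⟩
  · exact fun h h' => ⟨TomonoidFilter.nonempty_prodCoord φ h,
      TomonoidFilter.nonempty_revProdCoord φ h', TomonoidFilter.lambdaIn_prod_revProd hRT⟩
  · exact fun h h' => ⟨TomonoidFilter.nonempty_prodCoord φ h,
      TomonoidFilter.nonempty_powCoord φ h', TomonoidFilter.lambdaIn_prod_pow hRT⟩
  · exact fun h h' => ⟨TomonoidFilter.nonempty_revProdCoord φ h,
      TomonoidFilter.nonempty_revProdCoord φ h', TomonoidFilter.lambdaIn_revProd_revProd⟩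
  · exact fun h h' => ⟨TomonoidFilter.nonempty_powCoord φ h,
      TomonoidFilter.nonempty_revProdCoord φ h', fun cR cS =>
      -- A non-trivial set always lies in the family with all `z > 0`, so the first inclusion can be
      -- chosen.
      (TomonoidFilter.lambdaIn_pow_revProd cR cS).imp_right Or.inl⟩
  · exact fun h h' => ⟨TomonoidFilter.nonempty_powCoord φ h,
      TomonoidFilter.nonempty_powCoord φ h', TomonoidFilter.lambdaIn_pow_pow hRT⟩
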